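/- Fix $M>0$ and a positive integer $R$. For integers $n\ge 1$, $1\le r\le R$, $r<s\le p$ and a real $\lambda\in(0,M]$, let $\mathcal F_{s,\lambda}(M,r)$ be the set of covariance matrices $$\Sigma=V\Lambda V^T+I_p,\qquad \Lambda=\mathrm{diag}(\lambda_1,\dots,\lambda_r),\quad \lambda\le\lambda_r\le\dots\le\lambda_1\le M,$$ where $V\in\mathbb R^{p\times r}$ has orthonormal columns ($V^TV=I_r$) and at most $s$ nonzero rows; the projection $VV^T$ is determined by $\Sigma$. For $\epsilon\in[0,1]$ and a probability measure $Q$ on $\mathbb R^p$, let $X_1,\dots,X_n$ be i.i.d. with law $(1-\epsilon)N(0,\Sigma)+\epsilon Q$, and let $\mathbb P_{(\epsilon,\Sigma,Q)}$ be their joint law. Let $\|A\|_F=(\sum_{i,j}A_{ij}^2)^{1/2}$. There are constants $C,c,c'>0$, depending only on $M$ and $R$, such that for all such $n,p,r,s,\lambda$ and every $\epsilon\in[0,1]$, $$\inf_{\hat V}\ \sup_{\Sigma\in\mathcal F_{s,\lambda}(M,r)}\ \sup_Q\ \mathbb P_{(\epsilon,\Sigma,Q)}\left\{\|\hat V\hat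 V^T-VV^T\|_F^2\ \ge\ \left[C\left(\frac{s\log\frac{ep}{s}}{n\lambda^2}\vee\frac{\epsilon^2}{\lambda^2}\right)\right]\wedge c'\right\}\ \ge\ c,$$ where the infimum is over all estimators $\hat V=\hat V(X_1,\dots,X_n)\in\mathbb R^{p\times r}$ with orthonormal columns for which $\hat V\hat V^T$ is a measurable function of the data, and the outer supremum is over all $\Sigma=V\Lambda V^T+I_p$ in the class. -/

import Mathlib

open MeasureTheory ProbabilityTheory Matrix
open scoped ENNReal

noncomputable section

namespace RobustPCA

/-- The Frobenius norm of a real matrix. -/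
def fnorm {p q : ℕ} (A : Matrix (Fin p) (Fin q) ℝ) : ℝ :=
  Real.sqrt (∑ i, ∑ j, A i j ^ 2)

/-- `V ∈ O(p, r)`: the columns of the `p × r` matrix `V` are orthonormal. -/
def IsOrthonormal {p r : ℕ} (V : Matrix (Fin p) (Fin r) ℝ) : Prop :=
  Vᵀ * V = 1

/-- The set of (indices of) nonzero rows of `V`. -/
def rowSupport {p r : ℕ} (V : Matrix (Fin p) (Fin r) ℝ) : Set (Fin p) :=
  {i | ∃ j, V i j ≠ 0}

/-- The spiked covariance matrix `V Λ Vᵀ + I` with `Λ = diag ℓ`. -/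
def spikedCov {p r : ℕ} (V : Matrix (Fin p) (Fin r) ℝ) (ℓ : Fin r → ℝ) :
    Matrix (Fin p) (Fin p) ℝ :=
  V * Matrix.diagonal ℓ * Vᵀ + 1

/-- The sparse spiked covariance model, through its parameters `(V, ℓ)`: `V` is a `p × r` matrix
with orthonormal columns and at most `s` nonzero rows, and
`lam ≤ ℓ_r ≤ … ≤ ℓ_1 ≤ M`. The covariance matrix is `spikedCov V ℓ`. -/
structure IsSparseSpiked {p r : ℕ} (s : ℕ) (lam M : ℝ)
    (V : Matrix (Fin p) (Fin r) ℝ) (ℓ : Fin r → ℝ) : Prop where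
  orthonormal : IsOrthonormal V
  support_le : (rowSupport V).ncard ≤ s
  antitone : Antitone ℓ
  lower : ∀ j, lam ≤ ℓ j
  upper : ∀ j, ℓ j ≤ M

/-- The contaminated law `(1 - ε) N(0, S) + ε Q` of a single observation. -/
def contaminated {p : ℕ} (ε : ℝ) (S : Matrix (Fin p) (Fin p) ℝ)
    (Q : ProbabilityMeasure (EuclideanSpace ℝ (Fin p))) :
    Measure (EuclideanSpace ℝ (Fin p)) :=
  ENNReal.ofReal (1 - ε) • multivariateGaussian 0 S +
    ENNReal.ofReal ε • (Q : Measure (EuclideanSpace ℝ (Fin p)))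

/-- The joint law of `n` i.i.d. observations from `(1 - ε) N(0, S) + ε Q`. -/
def sampleLaw (n : ℕ) {p : ℕ} (ε : ℝ) (S : Matrix (Fin p) (Fin p) ℝ)
    (Q : ProbabilityMeasure (EuclideanSpace ℝ (Fin p))) :
    Measure (Fin n → EuclideanSpace ℝ (Fin p)) :=
  Measure.pi fun _ => contaminated ε S Q

/-- The estimators: maps `V̂` from the data to `p × r` matrices with orthonormal columns
such that the estimated projection `V̂ V̂ᵀ` is measurable. -/
def estimators (n p r : ℕ) :
    Set ((Fin n → EuclideanSpace ℝ (Fin p)) → Matrix (Fin p) (Fin r) ℝ) :=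
  {Vhat | (∀ x, IsOrthonormal (Vhat x)) ∧
    ∀ i j, Measurable fun x => (Vhat x * (Vhat x)ᵀ) i j}

/-- The event that the squared Frobenius loss `‖V̂ V̂ᵀ - V Vᵀ‖²` is at least `t`. -/
def lossEvent {n p r : ℕ}
    (Vhat : (Fin n → EuclideanSpace ℝ (Fin p)) → Matrix (Fin p) (Fin r) ℝ)
    (V : Matrix (Fin p) (Fin r) ℝ) (t : ℝ) : Set (Fin n → EuclideanSpace ℝ (Fin p)) :=
  {x | t ≤ fnorm (Vhat x * (Vhat x)ᵀ - V * Vᵀ) ^ 2}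

/-- The minimax probability
`inf_{V̂} sup_{(V, ℓ)} sup_Q P_{(ε, V diag(ℓ) Vᵀ + I, Q)} {‖V̂ V̂ᵀ - V Vᵀ‖² ≥ t}`. -/
def minimaxProb (n p r s : ℕ) (lam M ε t : ℝ) : ℝ≥0∞ :=
  ⨅ Vhat ∈ estimators n p r,
    ⨆ (V : Matrix (Fin p) (Fin r) ℝ) (ℓ : Fin r → ℝ) (_ : IsSparseSpiked s lam M V ℓ),
      ⨆ Q : ProbabilityMeasure (EuclideanSpace ℝ (Fin p)),
        sampleLaw n ε (spikedCov V ℓ) Q (lossEvent Vhat V t)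

/-- The rate `s log(ep/s) / (n lam²) ∨ ε² / lam²`. -/
def rate (n p s : ℕ) (lam ε : ℝ) : ℝ :=
  max ((s : ℝ) * Real.log (Real.exp 1 * p / s) / (n * lam ^ 2)) (ε ^ 2 / lam ^ 2)

end RobustPCA

end

namespace RobustPCA

/-! ### Products and images of measures with densities -/

section ProductDensity

variable {n : ℕ} {X : Type*} [MeasurableSpace X]

/-! All spikes are given the size `lam`. All but one of the spike directions are fixed coordinate
vectors; the last is a coordinate vector rotated by a small angle, with sine `s`, towards a sparse
unit vector `sparseDir ι θ` indexed by a word `θ`. Relative to the unrotated model, the likelihood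
ratio of one observation has second moment at most `exp (2 lam² s²)`
(`lintegral_gaussRatio_sq_spiked`), while projections move by order `s²` in squared Frobenius norm.
The two terms of the rate come from two ways of using this, and it is enough to prove the larger
one.

Sparsity term: the words have length `k` over an alphabet of `2m` letters (position in a block,
sign), where `k * log (2m)` is of order `s log(ep/s)`, here with `s` the sparsity. At a given
sample, the words that an estimator recovers well are pairwise close, so they lie in a Hamming ball
holding an exponentially small fraction of all words (`card_hammingDist_le`). Averaging under the
unrotated law yields a word whose success event is exponentially unlikely there
(`exists_measure_le_of_card_le`). Cauchy-Schwarz transfers this to the law of that word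
(`sq_pi_withDensity_le`) as long as `n lam² s²` is at most a small multiple of `k * log (2m)`. No
packing set and no entropy inequality are needed.

Contamination term: if `lam * s` is at most `ε / 2`, the chi-square divergence is at most `ε²`, so
the total variation distance is at most `ε`, and suitable contaminations make the rotated and
unrotated laws identical (`exists_contamination_of_density`). No estimator can be close to both
projections. -/

theorem lintegral_pi_prod : ∀ {n : ℕ} (μ : Fin n → Measure X) [∀ i, SigmaFinite (μ i)]
    (f : Fin n → X → ℝ≥0∞) (_ : ∀ i, Measurable (f i)),
    ∫⁻ x, ∏ i, f i (x i) ∂(Measure.pi μ) = ∏ i, ∫⁻ x, f i x ∂(μ i)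
  | 0, μ, _, f, _ => by simp
  | n + 1, μ, _, f, hf => by
    have ih := lintegral_pi_prod (fun i => μ (Fin.succ i)) (fun i => f (Fin.succ i))
      (fun i => hf _)
    have key := ((measurePreserving_piFinSuccAbove μ 0).symm).lintegral_comp_emb
      (MeasurableEquiv.measurableEmbedding _) (fun x => ∏ i, f i (x i))
    rw [← key, Fin.prod_univ_succ, ← ih]
    simp_rw [MeasurableEquiv.piFinSuccAbove_symm_apply, Fin.insertNthEquiv,
      Fin.prod_univ_succ, Fin.insertNth_zero, Equiv.coe_fn_mk, Fin.cons_succ,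
      Fin.zero_succAbove, Fin.cons_zero]
    refine lintegral_prod_mul (μ := μ 0) (ν := Measure.pi fun i => μ (Fin.succ i))
      (g := fun y : Fin n → X => ∏ i, f (Fin.succ i) (y i))
      (hf 0).aemeasurable (Measurable.aemeasurable ?_)
    exact Finset.measurable_prod _ fun i _ => (hf _).comp (measurable_pi_apply i)

theorem pi_withDensity (μ : Fin n → Measure X) [∀ i, SigmaFinite (μ i)]
    (f : Fin n → X → ℝ≥0∞) (hf : ∀ i, Measurable (f i))
    [∀ i, SigmaFinite ((μ i).withDensity (f i))] :
    Measure.pi (fun i => (μ i).withDensity (f i)) =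
      (Measure.pi μ).withDensity (fun x => ∏ i, f i (x i)) := by
  refine Measure.pi_eq fun s hs => ?_
  rw [withDensity_apply _ (MeasurableSet.univ_pi hs), ← lintegral_indicator
    (MeasurableSet.univ_pi hs)]
  have h : ∀ x : Fin n → X, (Set.univ.pi s).indicator (fun x => ∏ i, f i (x i)) x =
      ∏ i, (s i).indicator (f i) (x i) := by
    intro x
    by_cases hx : x ∈ Set.univ.pi s
    · rw [Set.indicator_of_mem hx]
      exact Finset.prod_congr rfl fun i _ =>
        (Set.indicator_of_mem (hx i (Set.mem_univ i)) _).symm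
    · rw [Set.indicator_of_notMem hx]
      simp only [Set.mem_univ_pi, not_forall] at hx
      obtain ⟨i, hi⟩ := hx
      exact (Finset.prod_eq_zero (Finset.mem_univ i) (Set.indicator_of_notMem hi _)).symm
  simp_rw [h]
  rw [lintegral_pi_prod μ _ fun i => (hf i).indicator (hs i)]
  refine Finset.prod_congr rfl fun i _ => ?_
  rw [lintegral_indicator (hs i), withDensity_apply _ (hs i)]

theorem map_withDensity_comp {Y : Type*} [MeasurableSpace Y] (μ : Measure X) (e : X → Y)
    (he : Measurable e) (f : Y → ℝ≥0∞) (hf : Measurable f) :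
    (μ.withDensity (fun x => f (e x))).map e = (μ.map e).withDensity f := by
  ext s hs
  rw [Measure.map_apply he hs, withDensity_apply _ (he hs), withDensity_apply _ hs,
    setLIntegral_map hs hf he]

end ProductDensity

/-! ### The density of a nondegenerate Gaussian vector -/

section GaussianDensity

variable {p : ℕ}

/-- The density of the centred Gaussian law on `ℝᵖ` with covariance matrix `S`. -/
noncomputable def gaussDensity (S : Matrix (Fin p) (Fin p) ℝ) (x : EuclideanSpace ℝ (Fin p)) : ℝ :=
  (Real.sqrt (2 * Real.pi))⁻¹ ^ p * (Real.sqrt S.det)⁻¹ *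
    Real.exp (-(x.ofLp ⬝ᵥ S⁻¹ *ᵥ x.ofLp) / 2)

theorem continuous_quadForm (A : Matrix (Fin p) (Fin p) ℝ) :
    Continuous fun x : EuclideanSpace ℝ (Fin p) => x.ofLp ⬝ᵥ A *ᵥ x.ofLp := by
  simp only [dotProduct, mulVec]
  fun_prop

theorem measurable_gaussDensity (S : Matrix (Fin p) (Fin p) ℝ) :
    Measurable (gaussDensity S) := by
  have := continuous_quadForm S⁻¹
  unfold gaussDensity
  exact (by fun_prop : Continuous _).measurable

theorem stdGaussian_eq_withDensity :
    stdGaussian (EuclideanSpace ℝ (Fin p)) =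
      volume.withDensity (fun x => ENNReal.ofReal
        ((Real.sqrt (2 * Real.pi))⁻¹ ^ p * Real.exp (-(x.ofLp ⬝ᵥ x.ofLp) / 2))) := by
  rw [← map_pi_eq_stdGaussian]
  have hm : Measurable (fun x : EuclideanSpace ℝ (Fin p) => ENNReal.ofReal
        ((Real.sqrt (2 * Real.pi))⁻¹ ^ p * Real.exp (-(x.ofLp ⬝ᵥ x.ofLp) / 2))) := by
    have : Continuous fun x : EuclideanSpace ℝ (Fin p) => x.ofLp ⬝ᵥ x.ofLp := by
      simp only [dotProduct]; fun_prop
    exact ENNReal.measurable_ofReal.comp (by fun_prop : Continuous _).measurable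
  have hg : gaussianReal 0 1 = volume.withDensity (gaussianPDF 0 1) :=
    gaussianReal_of_var_ne_zero 0 one_ne_zero
  have : SigmaFinite ((volume : Measure ℝ).withDensity (gaussianPDF 0 1)) := by
    rw [← hg]; infer_instance
  rw [show (Measure.pi fun _ : Fin p => gaussianReal 0 1) =
      (Measure.pi fun _ : Fin p => (volume : Measure ℝ).withDensity (gaussianPDF 0 1)) by rw [hg],
    pi_withDensity _ _ (fun _ => measurable_gaussianPDF 0 1), ← volume_pi]
  rw [← (PiLp.volume_preserving_toLp (Fin p)).map_eq,
    ← map_withDensity_comp _ _ (PiLp.volume_preserving_toLp (Fin p)).measurable _ hm]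
  congr 2
  ext x
  simp only [gaussianPDF]
  rw [← ENNReal.ofReal_prod_of_nonneg fun i _ => gaussianPDFReal_nonneg _ _ _]
  congr 1
  simp only [gaussianPDFReal, Finset.prod_mul_distrib, Finset.prod_const, Finset.card_univ,
    Fintype.card_fin, NNReal.coe_one, mul_one, sub_zero, ← Real.exp_sum]
  congr 2
  simp only [dotProduct, ← Finset.sum_neg_distrib, Finset.sum_div, pow_two]

/-- The law is the image of the standard Gaussian under the square root `T` of `S`, so the density
follows from the linear change of variables, with Jacobian `|det T| = √(det S)`. -/
theorem multivariateGaussian_eq_withDensity {S : Matrix (Fin p) (Fin p) ℝ} (hS : S.PosDef) :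
    multivariateGaussian 0 S =
      volume.withDensity (fun x => ENNReal.ofReal (gaussDensity S x)) := by
  open scoped MatrixOrder in
  set T := CFC.sqrt S with hT
  have hTT : T * T = S := CFC.sqrt_mul_sqrt_self _ hS.posSemidef.nonneg
  have hTs : Tᵀ = T := by
    have := (CFC.sqrt_nonneg S).isSelfAdjoint
    rw [isSelfAdjoint_iff, Matrix.star_eq_conjTranspose, conjTranspose_eq_transpose_of_trivial]
      at this
    exact this
  have hdet : T.det * T.det = S.det := by rw [← det_mul, hTT]
  have hdT : T.det ≠ 0 := by
    intro h; have := hS.det_pos; rw [← hdet, h] at this; simp at this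
  have hu : IsUnit T.det := hdT.isUnit
  have habs : |T.det| = Real.sqrt S.det := by rw [← hdet, Real.sqrt_mul_self_eq_abs]
  let L : EuclideanSpace ℝ (Fin p) →L[ℝ] EuclideanSpace ℝ (Fin p) := toEuclideanCLM (𝕜 := ℝ) T
  have hL : ∀ x, (L x).ofLp = T *ᵥ x.ofLp := fun x => by simp [L]
  have hLdet : LinearMap.det (L : EuclideanSpace ℝ (Fin p) →ₗ[ℝ] EuclideanSpace ℝ (Fin p))
      = T.det := by
    rw [show (L : EuclideanSpace ℝ (Fin p) →ₗ[ℝ] EuclideanSpace ℝ (Fin p)) = toLpLin 2 2 T from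
      coe_toEuclideanCLM_eq_toEuclideanLin T, toLpLin_eq_toLin, LinearMap.det_toLin]
  have h1 : multivariateGaussian 0 S = (stdGaussian (EuclideanSpace ℝ (Fin p))).map L := by
    simp only [multivariateGaussian, zero_add]; rfl
  have hden : ∀ x, ENNReal.ofReal
        ((Real.sqrt (2 * Real.pi))⁻¹ ^ p * Real.exp (-(x.ofLp ⬝ᵥ x.ofLp) / 2)) =
        ENNReal.ofReal |T.det| * ENNReal.ofReal (gaussDensity S (L x)) := by
    intro x
    rw [← ENNReal.ofReal_mul (abs_nonneg _)]
    congr 1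
    have hq : (L x).ofLp ⬝ᵥ S⁻¹ *ᵥ (L x).ofLp = x.ofLp ⬝ᵥ x.ofLp := by
      rw [hL, dotProduct_mulVec, ← dotProduct_mulVec, mulVec_mulVec, ← hTT, Matrix.mul_inv_rev,
        Matrix.mul_assoc, nonsing_inv_mul _ hu, Matrix.mul_one]
      rw [dotProduct_comm, ← dotProduct_transpose_mulVec, hTs, mulVec_mulVec,
        Matrix.mul_nonsing_inv _ hu, one_mulVec]
    rw [gaussDensity, hq, ← habs]
    have := abs_ne_zero.2 hdT
    field_simp
  rw [h1, stdGaussian_eq_withDensity]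
  simp_rw [hden]
  have hm := (measurable_gaussDensity S).ennreal_ofReal
  have hmL : Measurable fun x => ENNReal.ofReal (gaussDensity S (L x)) :=
    hm.comp L.continuous.measurable
  rw [show (fun x => ENNReal.ofReal |T.det| * ENNReal.ofReal (gaussDensity S (L x))) =
    ENNReal.ofReal |T.det| • (fun x => ENNReal.ofReal (gaussDensity S (L x))) from rfl,
    withDensity_smul _ hmL, Measure.map_smul,
    map_withDensity_comp _ _ L.continuous.measurable _ hm]
  have := Measure.map_linearMap_addHaar_eq_smul_addHaar (volume : Measure (EuclideanSpace ℝ (Fin p)))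
    (f := (L : EuclideanSpace ℝ (Fin p) →ₗ[ℝ] EuclideanSpace ℝ (Fin p))) (by rwa [hLdet])
  rw [hLdet] at this
  rw [show Measure.map (⇑L) volume = _ from this, withDensity_smul_measure, smul_smul,
    ← ENNReal.ofReal_mul (abs_nonneg _), ← abs_mul, mul_inv_cancel₀ hdT]
  simp

theorem lintegral_gaussDensity {S : Matrix (Fin p) (Fin p) ℝ} (hS : S.PosDef) :
    ∫⁻ x, ENNReal.ofReal (gaussDensity S x) = 1 := by
  have h := measure_univ (μ := multivariateGaussian (0 : EuclideanSpace ℝ (Fin p)) S)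
  rwa [multivariateGaussian_eq_withDensity hS, withDensity_apply _ MeasurableSet.univ,
    Measure.restrict_univ] at h

end GaussianDensity

variable {p : ℕ}

/-! ### Second moment of a Gaussian likelihood ratio -/

section LikelihoodRatio

theorem gaussDensity_pos {S : Matrix (Fin p) (Fin p) ℝ} (hS : S.PosDef)
    (x : EuclideanSpace ℝ (Fin p)) : 0 < gaussDensity S x := by
  have := Real.sqrt_pos.2 hS.det_pos
  unfold gaussDensity
  positivity

/-- The likelihood ratio of `N(0, S₁)` with respect to `N(0, S₀)`. -/
noncomputable def gaussRatio (S₀ S₁ : Matrix (Fin p) (Fin p) ℝ) (x : EuclideanSpace ℝ (Fin p)) :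
    ℝ≥0∞ :=
  ENNReal.ofReal (gaussDensity S₁ x / gaussDensity S₀ x)

theorem measurable_gaussRatio (S₀ S₁ : Matrix (Fin p) (Fin p) ℝ) :
    Measurable (gaussRatio S₀ S₁) :=
  ((measurable_gaussDensity S₁).div (measurable_gaussDensity S₀)).ennreal_ofReal

theorem multivariateGaussian_withDensity_gaussRatio {S₀ S₁ : Matrix (Fin p) (Fin p) ℝ}
    (h₀ : S₀.PosDef) (h₁ : S₁.PosDef) :
    (multivariateGaussian 0 S₀).withDensity (gaussRatio S₀ S₁) = multivariateGaussian 0 S₁ := by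
  rw [multivariateGaussian_eq_withDensity h₀, multivariateGaussian_eq_withDensity h₁,
    ← withDensity_mul _ (measurable_gaussDensity S₀).ennreal_ofReal (measurable_gaussRatio S₀ S₁)]
  congr 1
  ext x
  have hx := gaussDensity_pos h₀ x
  rw [Pi.mul_apply, gaussRatio, ← ENNReal.ofReal_mul hx.le, mul_div_cancel₀ _ hx.ne']

/-- The integrand, density of `S₁` squared over density of `S₀`, is again Gaussian up to a constant:
its precision matrix is `2 S₁⁻¹ - S₀⁻¹`. The right-hand side is the ratio of normalising constants.
-/
theorem lintegral_gaussRatio_sq {S₀ S₁ : Matrix (Fin p) (Fin p) ℝ}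
    (h₀ : S₀.PosDef) (h₁ : S₁.PosDef) (hB : ((2 : ℝ) • S₁⁻¹ - S₀⁻¹).PosDef) :
    ∫⁻ x, gaussRatio S₀ S₁ x ^ 2 ∂(multivariateGaussian 0 S₀) =
      ENNReal.ofReal (Real.sqrt (S₀.det / (S₁.det ^ 2 * ((2 : ℝ) • S₁⁻¹ - S₀⁻¹).det))) := by
  set B := (2 : ℝ) • S₁⁻¹ - S₀⁻¹ with hBdef
  have hd₀ := h₀.det_pos
  have hd₁ := h₁.det_pos
  have hdB := hB.det_pos
  have hinv : B⁻¹⁻¹ = B := nonsing_inv_nonsing_inv _ hdB.ne'.isUnit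
  have hden : ∀ x, ENNReal.ofReal (gaussDensity S₀ x) * gaussRatio S₀ S₁ x ^ 2 =
      ENNReal.ofReal (Real.sqrt (S₀.det / (S₁.det ^ 2 * B.det))) *
        ENNReal.ofReal (gaussDensity B⁻¹ x) := by
    intro x
    have h0 := gaussDensity_pos h₀ x
    have h1 := gaussDensity_pos h₁ x
    rw [gaussRatio, ← ENNReal.ofReal_pow (by positivity), ← ENNReal.ofReal_mul h0.le,
      ← ENNReal.ofReal_mul (Real.sqrt_nonneg _)]
    congr 1
    have e1 : gaussDensity S₀ x * (gaussDensity S₁ x / gaussDensity S₀ x) ^ 2 =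
        gaussDensity S₁ x ^ 2 / gaussDensity S₀ x := by field_simp
    rw [e1, div_eq_iff h0.ne']
    have hq : x.ofLp ⬝ᵥ B *ᵥ x.ofLp =
        2 * (x.ofLp ⬝ᵥ S₁⁻¹ *ᵥ x.ofLp) - x.ofLp ⬝ᵥ S₀⁻¹ *ᵥ x.ofLp := by
      rw [hBdef, sub_mulVec, dotProduct_sub, smul_mulVec, dotProduct_smul, smul_eq_mul]
    simp only [gaussDensity, hinv, hq]
    have hexp : ∀ a b : ℝ, Real.exp (-(2 * a - b) / 2) * Real.exp (-b / 2) =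
        Real.exp (-a / 2) ^ 2 := by
      intro a b
      rw [← Real.exp_add, ← Real.exp_nat_mul]; congr 1; push_cast; ring
    have hsq : Real.sqrt (S₀.det / (S₁.det ^ 2 * B.det)) * (Real.sqrt (B⁻¹).det)⁻¹ *
        (Real.sqrt S₀.det)⁻¹ = (Real.sqrt S₁.det)⁻¹ ^ 2 := by
      rw [det_nonsing_inv, Ring.inverse_eq_inv', Real.sqrt_inv, inv_inv,
        Real.sqrt_div hd₀.le, Real.sqrt_mul (by positivity), Real.sqrt_sq hd₁.le, inv_pow,
        Real.sq_sqrt hd₁.le]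
      have := (Real.sqrt_pos.2 hd₀).ne'
      have := (Real.sqrt_pos.2 hdB).ne'
      field_simp
    rw [mul_pow, mul_pow, ← hexp _ (x.ofLp ⬝ᵥ S₀⁻¹ *ᵥ x.ofLp), ← hsq]
    ring
  rw [multivariateGaussian_eq_withDensity h₀, lintegral_withDensity_eq_lintegral_mul _
    (measurable_gaussDensity S₀).ennreal_ofReal ((measurable_gaussRatio S₀ S₁).pow_const 2)]
  simp only [Pi.mul_apply]
  simp_rw [hden]
  rw [lintegral_const_mul _ (measurable_gaussDensity _).ennreal_ofReal,
    lintegral_gaussDensity hB.inv, mul_one]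

end LikelihoodRatio

/-! ### Spiked covariances that differ in one direction -/

section SpikedProjection

variable {D : Matrix (Fin p) (Fin p) ℝ} {v u : Fin p → ℝ}

theorem dotProduct_self_nonneg_real (x : Fin p → ℝ) : 0 ≤ x ⬝ᵥ x :=
  Finset.sum_nonneg fun i _ => mul_self_nonneg (x i)

theorem idempotent_add_vecMulVec (hDD : D * D = D) (hDs : Dᵀ = D) (hv : D *ᵥ v = 0)
    (hvv : v ⬝ᵥ v = 1) :
    (D + vecMulVec v v) * (D + vecMulVec v v) = D + vecMulVec v v := by
  have h1 : v ᵥ* D = 0 := by rw [← hDs, vecMul_transpose, hv]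
  rw [add_mul, mul_add, mul_add, hDD, mul_vecMulVec, hv, vecMulVec_mul, h1,
    vecMulVec_mul_vecMulVec, hvv]
  simp

theorem transpose_add_vecMulVec (hDs : Dᵀ = D) :
    (D + vecMulVec v v)ᵀ = D + vecMulVec v v := by
  rw [transpose_add, hDs, transpose_vecMulVec]

theorem dotProduct_mulVec_idempotent_nonneg (hDD : D * D = D) (hDs : Dᵀ = D) (x : Fin p → ℝ) :
    0 ≤ x ⬝ᵥ D *ᵥ x := by
  have : x ⬝ᵥ D *ᵥ x = (D *ᵥ x) ⬝ᵥ (D *ᵥ x) := by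
    conv_lhs => rw [← hDD, ← mulVec_mulVec]
    rw [dotProduct_mulVec, ← mulVec_transpose, hDs]
  rw [this]
  exact dotProduct_self_nonneg_real _

theorem dotProduct_mulVec_idempotent_le (hDD : D * D = D) (hDs : Dᵀ = D) (x : Fin p → ℝ) :
    x ⬝ᵥ D *ᵥ x ≤ x ⬝ᵥ x := by
  have h := dotProduct_mulVec_idempotent_nonneg (D := 1 - D) (by simp [sub_mul, mul_sub, hDD])
    (by rw [transpose_sub, transpose_one, hDs]) x
  rw [sub_mulVec, one_mulVec, dotProduct_sub] at h
  linarith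

theorem dotProduct_vecMulVec_mulVec (a b x : Fin p → ℝ) :
    x ⬝ᵥ vecMulVec a b *ᵥ x = (a ⬝ᵥ x) * (b ⬝ᵥ x) := by
  rw [vecMulVec_mulVec]
  simp [dotProduct_comm, mul_comm]

theorem isHermitian_of_transpose_eq {A : Matrix (Fin p) (Fin p) ℝ} (h : Aᵀ = A) :
    A.IsHermitian := by
  rw [IsHermitian, conjTranspose_eq_transpose_of_trivial, h]

theorem posDef_spiked {lam : ℝ} (hlam : 0 ≤ lam) (hDD : D * D = D) (hDs : Dᵀ = D) :
    (lam • D + 1).PosDef := by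
  refine PosDef.of_dotProduct_mulVec_pos (isHermitian_of_transpose_eq ?_) fun x hx => ?_
  · rw [transpose_add, transpose_smul, hDs, transpose_one]
  · rw [star_trivial, add_mulVec, smul_mulVec, one_mulVec, dotProduct_add, dotProduct_smul,
      smul_eq_mul]
    have := dotProduct_mulVec_idempotent_nonneg hDD hDs x
    have h2 : 0 < x ⬝ᵥ x := by
      refine lt_of_le_of_ne (dotProduct_self_nonneg_real _) fun h => hx (dotProduct_self_eq_zero.1 h.symm)
    positivity

theorem inv_spiked {lam : ℝ} (hlam : 0 ≤ lam) (hDD : D * D = D) :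
    (lam • D + 1)⁻¹ = 1 - (lam / (1 + lam)) • D := by
  have h : 1 + lam ≠ 0 := by positivity
  refine inv_eq_right_inv ?_
  rw [add_mul, mul_sub, one_mul, smul_mul_assoc, smul_mul_assoc, mul_smul_comm, hDD, mul_one,
    smul_smul, ← sub_eq_zero]
  rw [show lam • D - (lam * (lam / (1 + lam))) • D + (1 - (lam / (1 + lam)) • D) - 1 =
    (lam - lam * (lam / (1 + lam)) - lam / (1 + lam)) • D by module]
  rw [show lam - lam * (lam / (1 + lam)) - lam / (1 + lam) = 0 by field_simp; ring, zero_smul]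

theorem det_spiked {lam : ℝ} (hv : D *ᵥ v = 0) (hvv : v ⬝ᵥ v = 1) :
    (lam • (D + vecMulVec v v) + 1).det = (lam • D + 1).det * (1 + lam) := by
  have h : lam • (D + vecMulVec v v) + 1 = (lam • D + 1) * (1 + vecMulVec (lam • v) v) := by
    rw [add_mul, mul_add, mul_add, smul_mul_assoc, smul_mul_assoc, mul_vecMulVec, mulVec_smul, hv]
    simp [smul_vecMulVec]
    abel
  rw [h, det_mul, vecMulVec_eq Unit, det_one_add_replicateCol_mul_replicateRow]
  simp [hvv]

variable {c s : ℝ}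

/-- The perturbation has rank two, so Sylvester's identity `det (1 + AB) = det (1 + BA)` reduces the
determinant to a `2 × 2` one. -/
theorem det_one_sub_smul_sub (β : ℝ) {w : Fin p → ℝ} (hvv : v ⬝ᵥ v = 1) (hww : w ⬝ᵥ w = 1) :
    (1 - β • ((2 : ℝ) • vecMulVec w w - vecMulVec v v)).det =
      1 - β - 2 * β ^ 2 * (1 - (v ⬝ᵥ w) ^ 2) := by
  have h : 1 - β • ((2 : ℝ) • vecMulVec w w - vecMulVec v v) =
      1 + (of fun i => ![-(2 * β) * w i, β * v i]) * (of ![w, v]) := by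
    rw [sub_eq_add_neg]
    congr 1
    ext i j
    simp [mul_apply, Fin.sum_univ_two, vecMulVec_apply]
    ring
  have hwv : w ⬝ᵥ v = v ⬝ᵥ w := dotProduct_comm _ _
  have hM : (1 + (of ![w, v]) * (of fun i => ![-(2 * β) * w i, β * v i]) : Matrix (Fin 2) (Fin 2) ℝ)
      = !![1 - 2 * β, β * (v ⬝ᵥ w); -(2 * β) * (v ⬝ᵥ w), 1 + β] := by
    have e : (of ![w, v]) * (of fun i => ![-(2 * β) * w i, β * v i]) =
        !![w ⬝ᵥ ((-(2 * β)) • w), w ⬝ᵥ (β • v); v ⬝ᵥ ((-(2 * β)) • w), v ⬝ᵥ (β • v)] := by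
      ext i j
      fin_cases i <;> fin_cases j <;> rfl
    rw [e]
    simp only [dotProduct_smul, hvv, hww, hwv, smul_eq_mul, one_fin_two]
    ext i j
    fin_cases i <;> fin_cases j <;> simp <;> ring
  rw [h, det_one_add_mul_comm, hM, det_fin_two_of]
  ring

theorem det_two_inv_sub_inv {lam : ℝ} (hlam : 0 ≤ lam) {w : Fin p → ℝ} (hDD : D * D = D)
    (hDs : Dᵀ = D) (hv : D *ᵥ v = 0) (hvv : v ⬝ᵥ v = 1) (hw : D *ᵥ w = 0) (hww : w ⬝ᵥ w = 1) :
    (lam • (D + vecMulVec v v) + 1).det *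
      ((2 : ℝ) • (lam • (D + vecMulVec w w) + 1)⁻¹ - (lam • (D + vecMulVec v v) + 1)⁻¹).det =
      1 - 2 * lam ^ 2 * (1 - (v ⬝ᵥ w) ^ 2) / (1 + lam) := by
  have hl : 1 + lam ≠ 0 := by positivity
  set β := lam / (1 + lam) with hβ
  -- Since `D` annihilates `v` and `w`, the common spikes split off as a factor, which then cancels
  -- against the determinant of `lam • D + 1`.
  have hB : (2 : ℝ) • (lam • (D + vecMulVec w w) + 1)⁻¹ - (lam • (D + vecMulVec v v) + 1)⁻¹ =
      (1 - β • D) * (1 - β • ((2 : ℝ) • vecMulVec w w - vecMulVec v v)) := by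
    rw [inv_spiked hlam (idempotent_add_vecMulVec hDD hDs hv hvv),
      inv_spiked hlam (idempotent_add_vecMulVec hDD hDs hw hww), ← hβ]
    have e : D * ((2 : ℝ) • vecMulVec w w - vecMulVec v v) = 0 := by
      rw [mul_sub, mul_smul_comm, mul_vecMulVec, mul_vecMulVec, hw, hv]
      simp
    rw [sub_mul, mul_sub, mul_sub, smul_mul_assoc, smul_mul_assoc, mul_smul_comm β D, e]
    simp only [one_mul, mul_one, smul_zero]
    module
  have hD1 : (lam • D + 1).det * (1 - β • D).det = 1 := by
    rw [← inv_spiked hlam hDD, ← det_mul, mul_nonsing_inv _ (posDef_spiked hlam hDD hDs).det_pos.ne'.isUnit,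
      det_one]
  rw [hB, det_spiked hv hvv, det_mul, det_one_sub_smul_sub β hvv hww]
  rw [show ∀ a b d : ℝ, (a * (1 + lam)) * (b * d) = (a * b) * ((1 + lam) * d) by intros; ring, hD1,
    hβ]
  field_simp
  ring

theorem posDef_two_inv_sub_inv {lam : ℝ} (hlam : 0 ≤ lam) (hDD : D * D = D) (hDs : Dᵀ = D)
    (hv : D *ᵥ v = 0) (hvv : v ⬝ᵥ v = 1) (hu : D *ᵥ u = 0) (huu : u ⬝ᵥ u = 1) (huv : v ⬝ᵥ u = 0)
    (hcs : c ^ 2 + s ^ 2 = 1) (hs : 2 * lam * s ^ 2 < 1) :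
    ((2 : ℝ) • (lam • (D + vecMulVec (c • v + s • u) (c • v + s • u)) + 1)⁻¹ -
      (lam • (D + vecMulVec v v) + 1)⁻¹).PosDef := by
  have hl : 0 < 1 + lam := by positivity
  set w := c • v + s • u with hwdef
  have hw : D *ᵥ w = 0 := by rw [hwdef, mulVec_add, mulVec_smul, mulVec_smul, hv, hu]; simp
  have hww : w ⬝ᵥ w = 1 := by
    rw [hwdef]
    simp only [add_dotProduct, dotProduct_add, smul_dotProduct, dotProduct_smul, hvv, huu, huv,
      dotProduct_comm u v, smul_eq_mul]
    linarith
  have hP := idempotent_add_vecMulVec hDD hDs hv hvv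
  have hPs := transpose_add_vecMulVec (v := v) hDs
  have hPu : (D + vecMulVec v v) *ᵥ u = 0 := by
    rw [add_mulVec, hu, vecMulVec_mulVec, huv]; simp
  have hQ := idempotent_add_vecMulVec hP hPs hPu huu
  have hQs := transpose_add_vecMulVec (v := u) hPs
  rw [inv_spiked hlam hP, inv_spiked hlam (idempotent_add_vecMulVec hDD hDs hw hww)]
  set β := lam / (1 + lam) with hβ
  have hβ0 : 0 ≤ β := by positivity
  have hβ1 : β * (1 + 2 * s ^ 2) < 1 := by
    rw [hβ, div_mul_eq_mul_div, div_lt_one hl]; linarith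
  refine PosDef.of_dotProduct_mulVec_pos (isHermitian_of_transpose_eq ?_) fun x hx => ?_
  · simp only [transpose_sub, transpose_smul, transpose_add, transpose_one, transpose_vecMulVec,
      hDs]
  · have h2 : 0 < x ⬝ᵥ x :=
      lt_of_le_of_ne (dotProduct_self_nonneg_real _) fun h => hx (dotProduct_self_eq_zero.1 h.symm)
    have h3 := dotProduct_mulVec_idempotent_nonneg hDD hDs x
    have h4 := dotProduct_mulVec_idempotent_le hQ hQs x
    have hwx : w ⬝ᵥ x = c * (v ⬝ᵥ x) + s * (u ⬝ᵥ x) := by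
      rw [hwdef, add_dotProduct, smul_dotProduct, smul_dotProduct]; rfl
    simp only [star_trivial, sub_mulVec, smul_mulVec, add_mulVec, one_mulVec, dotProduct_sub,
      dotProduct_smul, dotProduct_add, dotProduct_vecMulVec_mulVec, smul_eq_mul, hwx] at h4 ⊢
    generalize x ⬝ᵥ x = X at *
    generalize x ⬝ᵥ D *ᵥ x = d at *
    generalize v ⬝ᵥ x = a at *
    generalize u ⬝ᵥ x = b at *
    have hc : c ^ 2 = 1 - s ^ 2 := by linarith
    -- On the plane of `v` and `u`, the form of `2wwᵀ - vvᵀ` is at most `1 + 2s²` times the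
    -- identity; the defect is an explicit sum of squares. The condition `2 lam s² < 1` says exactly
    -- that `β (1 + 2s²) < 1`.
    have h5 : 2 * (c * a + s * b) ^ 2 - a ^ 2 ≤ (1 + 2 * s ^ 2) * (a ^ 2 + b ^ 2) := by
      have : (1 + 2 * s ^ 2) * (a ^ 2 + b ^ 2) - (2 * (c * a + s * b) ^ 2 - a ^ 2) =
          (2 * s * a - c * b) ^ 2 + s ^ 2 * b ^ 2 + (1 - s ^ 2 - c ^ 2) * (2 * a ^ 2 + b ^ 2) := by
        ring
      rw [hc] at this
      nlinarith [sq_nonneg (2 * s * a - c * b), mul_nonneg (sq_nonneg s) (sq_nonneg b)]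
    have h6 : d + (2 * (c * a + s * b) ^ 2 - a ^ 2) ≤ (1 + 2 * s ^ 2) * X := by
      nlinarith [mul_nonneg (sq_nonneg s) h3, mul_le_mul_of_nonneg_left h4 (by positivity : 0 ≤ 1 + 2 * s ^ 2)]
    have h7 := mul_le_mul_of_nonneg_left h6 hβ0
    have h8 := mul_lt_mul_of_pos_right hβ1 h2
    nlinarith

/-- The second moment of the likelihood ratio between two spiked models that share all spikes but
the last one. -/
theorem lintegral_gaussRatio_sq_spiked {lam : ℝ} (hlam : 0 ≤ lam) (hDD : D * D = D) (hDs : Dᵀ = D)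
    (hv : D *ᵥ v = 0) (hvv : v ⬝ᵥ v = 1) (hu : D *ᵥ u = 0) (huu : u ⬝ᵥ u = 1) (huv : v ⬝ᵥ u = 0)
    (hcs : c ^ 2 + s ^ 2 = 1) (hs : 2 * lam * s ^ 2 < 1) (hs' : 4 * lam ^ 2 * s ^ 2 ≤ 1) :
    ∫⁻ x, gaussRatio (lam • (D + vecMulVec v v) + 1)
        (lam • (D + vecMulVec (c • v + s • u) (c • v + s • u)) + 1) x ^ 2
        ∂(multivariateGaussian 0 (lam • (D + vecMulVec v v) + 1)) ≤
      ENNReal.ofReal (Real.exp (2 * lam ^ 2 * s ^ 2)) := by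
  have hl : 0 < 1 + lam := by positivity
  have hB := posDef_two_inv_sub_inv hlam hDD hDs hv hvv hu huu huv hcs hs
  set w := c • v + s • u with hwdef
  have hw : D *ᵥ w = 0 := by rw [hwdef, mulVec_add, mulVec_smul, mulVec_smul, hv, hu]; simp
  have hww : w ⬝ᵥ w = 1 := by
    rw [hwdef]
    simp only [add_dotProduct, dotProduct_add, smul_dotProduct, dotProduct_smul, hvv, huu, huv,
      dotProduct_comm u v, smul_eq_mul]
    linarith
  have hvw : v ⬝ᵥ w = c := by
    rw [hwdef, dotProduct_add, dotProduct_smul, dotProduct_smul, hvv, huv]; simp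
  have h₀ := posDef_spiked hlam (idempotent_add_vecMulVec hDD hDs hv hvv)
    (transpose_add_vecMulVec hDs)
  have h₁ := posDef_spiked hlam (idempotent_add_vecMulVec hDD hDs hw hww)
    (transpose_add_vecMulVec hDs)
  rw [lintegral_gaussRatio_sq h₀ h₁ hB]
  refine ENNReal.ofReal_le_ofReal ?_
  have hdet := det_two_inv_sub_inv hlam hDD hDs hv hvv hw hww
  rw [hvw, show 1 - c ^ 2 = s ^ 2 by linarith] at hdet
  have hd0 := h₀.det_pos
  have hdB := hB.det_pos
  have hsame : (lam • (D + vecMulVec w w) + 1).det = (lam • (D + vecMulVec v v) + 1).det := by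
    rw [det_spiked hv hvv, det_spiked hw hww]
  rw [hsame]
  generalize (lam • (D + vecMulVec v v) + 1).det = d at *
  generalize ((2 : ℝ) • (lam • (D + vecMulVec w w) + 1)⁻¹ - (lam • (D + vecMulVec v v) + 1)⁻¹).det = b at *
  have e1 : d / (d ^ 2 * b) = 1 / (d * b) := by field_simp
  have hy : 2 * lam ^ 2 * s ^ 2 / (1 + lam) ≤ 2 * lam ^ 2 * s ^ 2 :=
    div_le_self (by positivity) (by linarith)
  rw [e1, hdet, Real.sqrt_le_left (Real.exp_pos _).le, ← Real.exp_nat_mul]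
  set y := 2 * lam ^ 2 * s ^ 2 with hydef
  -- For `0 ≤ y ≤ 1/2`, `1 / (1 - y) ≤ 1 + 2y ≤ exp (2y)`; the square root then gives `exp y`.
  have hy2 : y ≤ 1 / 2 := by linarith
  have hy0 : 0 ≤ y := by positivity
  rw [div_le_iff₀ (by linarith)]
  have h1 := Real.add_one_le_exp (((2 : ℕ) : ℝ) * y)
  push_cast at h1 ⊢
  nlinarith

end SpikedProjection

/-! ### Change of measure and averaging over hypotheses -/

section ChangeOfMeasure

variable {X : Type*} [MeasurableSpace X]

/-- Cauchy-Schwarz applied to `g` and the constant `1` on `A`. -/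
theorem sq_withDensity_le (μ : Measure X) [SFinite μ] {g : X → ℝ≥0∞} (hg : Measurable g) (A : Set X) :
    (μ.withDensity g) A ^ 2 ≤ (∫⁻ x, g x ^ 2 ∂μ) * μ A := by
  rw [withDensity_apply' _ A]
  have h := ENNReal.lintegral_mul_le_Lp_mul_Lq (μ.restrict A) Real.HolderConjugate.two_two
    hg.aemeasurable (aemeasurable_const (b := (1 : ℝ≥0∞)))
  simp only [Pi.mul_apply, mul_one, ENNReal.one_rpow, lintegral_const, Measure.restrict_apply_univ,
    one_mul] at h
  have h2 := pow_le_pow_left₀ (zero_le) h 2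
  have e : ∀ a : ℝ≥0∞, (a ^ (1 / (2 : ℝ))) ^ 2 = a := fun a => by
    rw [← ENNReal.rpow_natCast, ← ENNReal.rpow_mul]; norm_num
  rw [mul_pow, e, e] at h2
  refine h2.trans (mul_le_mul_left ?_ _)
  simp only [ENNReal.rpow_two]
  exact setLIntegral_le_lintegral _ _

theorem sq_pi_withDensity_le {n : ℕ} (μ : Measure X) [IsProbabilityMeasure μ] {g : X → ℝ≥0∞}
    (hg : Measurable g) [IsProbabilityMeasure (μ.withDensity g)] (A : Set (Fin n → X)) :
    (Measure.pi fun _ : Fin n => μ.withDensity g) A ^ 2 ≤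
      (∫⁻ x, g x ^ 2 ∂μ) ^ n * (Measure.pi fun _ : Fin n => μ) A := by
  rw [pi_withDensity _ _ fun _ => hg]
  refine (sq_withDensity_le _
    (Finset.measurable_prod _ fun i _ => hg.comp (measurable_pi_apply i)) A).trans_eq ?_
  congr 1
  simp_rw [← Finset.prod_pow, Function.comp_def]
  rw [lintegral_pi_prod _ (fun _ x => g x ^ 2) fun _ => hg.pow_const 2]
  simp

/-- Double counting: the sum of the `μ (A θ)` is the integral of the number of sets containing `x`,
so the smallest of them is at most the average. -/
theorem exists_measure_le_of_card_le {Θ : Type*} [Fintype Θ] [Nonempty Θ] (μ : Measure X)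
    [IsProbabilityMeasure μ] (A : Θ → Set X) (hA : ∀ θ, MeasurableSet (A θ)) (N : ℝ)
    (hN : ∀ x, ((Set.ncard {θ | x ∈ A θ} : ℕ) : ℝ) ≤ N) :
    ∃ θ, μ (A θ) ≤ ENNReal.ofReal (N / Fintype.card Θ) := by
  classical
  have hsum : ∑ θ, μ (A θ) ≤ ENNReal.ofReal N := by
    calc ∑ θ, μ (A θ) = ∫⁻ x, ∑ θ, (A θ).indicator 1 x ∂μ := by
          rw [lintegral_finsetSum _ fun θ _ => measurable_one.indicator (hA θ)]
          exact Finset.sum_congr rfl fun θ _ => (lintegral_indicator_one (hA θ)).symm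
      _ ≤ ∫⁻ _, ENNReal.ofReal N ∂μ := by
          refine lintegral_mono fun x => ?_
          have : ∑ θ, (A θ).indicator (1 : X → ℝ≥0∞) x = (Set.ncard {θ | x ∈ A θ} : ℕ) := by
            simp [Set.indicator_apply, Set.ncard_eq_toFinset_card']
          rw [this, ← ENNReal.ofReal_natCast]
          exact ENNReal.ofReal_le_ofReal (hN x)
      _ = ENNReal.ofReal N := by simp
  have hc : (0 : ℝ) < Fintype.card Θ := by exact_mod_cast Fintype.card_pos
  obtain ⟨θ, hθ⟩ := Finite.exists_min fun θ => μ (A θ)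
  refine ⟨θ, ?_⟩
  rw [ENNReal.ofReal_div_of_pos hc, ENNReal.ofReal_natCast, ENNReal.le_div_iff_mul_le
    (Or.inl (by simp)) (Or.inl (by simp)), mul_comm, ← nsmul_eq_mul]
  refine le_trans ?_ hsum
  rw [← Finset.card_univ]
  exact Finset.card_nsmul_le_sum _ _ _ fun θ' _ => hθ θ'

end ChangeOfMeasure

/-! ### Contaminations that make two laws coincide -/

section Contamination

variable {X : Type*} [MeasurableSpace X]

/-- Each contamination supplies the mass the law lacks relative to the other, scaled by `1 - ε`;
both fill the remaining budget `κ` with the same multiple of `P₀`. -/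
theorem exists_contamination (P₀ P₁ α β : Measure X) [IsProbabilityMeasure P₀]
    [IsProbabilityMeasure P₁] (h : P₀ + α = P₁ + β) {ε : ℝ} (hε : 0 < ε)
    (hα : α Set.univ ≤ ENNReal.ofReal ε) :
    ∃ Q₀ Q₁ : ProbabilityMeasure X,
      ENNReal.ofReal (1 - ε) • P₀ + ENNReal.ofReal ε • (Q₀ : Measure X) =
        ENNReal.ofReal (1 - ε) • P₁ + ENNReal.ofReal ε • (Q₁ : Measure X) := by
  set e := ENNReal.ofReal ε
  set e' := ENNReal.ofReal (1 - ε)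
  have he0 : e ≠ 0 := by simpa [e] using hε
  have het : e ≠ ∞ := ENNReal.ofReal_ne_top
  have he1 : e' ≤ 1 := by
    rw [← ENNReal.ofReal_one]; exact ENNReal.ofReal_le_ofReal (by linarith)
  have hβ : β Set.univ = α Set.univ := by
    have := congrArg (fun m : Measure X => m Set.univ) h
    simp only [Measure.add_apply, measure_univ] at this
    exact ((ENNReal.add_right_inj ENNReal.one_ne_top).1 this).symm
  have hle : e' * α Set.univ ≤ e := (mul_le_of_le_one_left (zero_le) he1).trans hα
  set κ := e - e' * α Set.univ
  have hκ : e' * α Set.univ + κ = e := add_tsub_cancel_of_le hle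
  have hprob : ∀ ν : Measure X, ν Set.univ = α Set.univ →
      IsProbabilityMeasure (e⁻¹ • (e' • ν + κ • P₀)) := fun ν hν => ⟨by
    simp only [Measure.smul_apply, Measure.add_apply, measure_univ, smul_eq_mul, hν, mul_one, hκ]
    exact ENNReal.inv_mul_cancel he0 het⟩
  refine ⟨⟨_, hprob α rfl⟩, ⟨_, hprob β hβ⟩, ?_⟩
  simp only [ProbabilityMeasure.coe_mk, smul_smul, ENNReal.mul_inv_cancel he0 het, one_smul]
  rw [← add_assoc, ← add_assoc, ← smul_add, ← smul_add, h]

theorem exists_contamination_of_density (P₀ : Measure X) [IsProbabilityMeasure P₀] {g : X → ℝ≥0∞}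
    (hg : Measurable g) (hgt : ∀ x, g x ≠ ∞) [IsProbabilityMeasure (P₀.withDensity g)] {ε : ℝ}
    (hε : 0 < ε) (hρ : ∫⁻ x, g x ^ 2 ∂P₀ ≤ ENNReal.ofReal (1 + ε ^ 2)) :
    ∃ Q₀ Q₁ : ProbabilityMeasure X,
      ENNReal.ofReal (1 - ε) • P₀ + ENNReal.ofReal ε • (Q₀ : Measure X) =
        ENNReal.ofReal (1 - ε) • P₀.withDensity g + ENNReal.ofReal ε • (Q₁ : Measure X) := by
  have hm1 : Measurable fun x => 1 - g x := measurable_const.sub hg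
  have hm2 : Measurable fun x => g x - 1 := hg.sub measurable_const
  have hadd : P₀ + P₀.withDensity (fun x => g x - 1) =
      P₀.withDensity g + P₀.withDensity (fun x => 1 - g x) := by
    rw [← withDensity_add_left hg]
    have h1 : P₀ + P₀.withDensity (fun x => g x - 1) =
        P₀.withDensity 1 + P₀.withDensity (fun x => g x - 1) := by rw [withDensity_one]
    rw [h1, ← withDensity_add_left measurable_one]
    congr 1
    ext x
    simp only [Pi.add_apply, Pi.one_apply]
    rw [add_tsub_eq_max, add_tsub_eq_max, max_comm]
  -- Subtraction truncates at zero, so this is the total variation distance. Pointwise `(1 - g)₊² ≤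
  -- 1 + g² - 2g`, whose integral is the chi-square divergence, at most `ε²`.
  have hbound : P₀.withDensity (fun x => 1 - g x) Set.univ ≤ ENNReal.ofReal ε := by
    have h1 := sq_withDensity_le P₀ hm1 Set.univ
    rw [measure_univ (μ := P₀), mul_one] at h1
    have h2 : ∫⁻ x, (1 - g x) ^ 2 ∂P₀ ≤ ENNReal.ofReal (ε ^ 2) := by
      have hpt : ∀ x, (1 - g x) ^ 2 + 2 * g x ≤ 1 + g x ^ 2 := by
        intro x
        lift g x to NNReal using hgt x with a
        norm_cast
        rw [← NNReal.coe_le_coe]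
        rcases le_total a 1 with ha | ha
        · push_cast [NNReal.coe_sub ha]
          nlinarith
        · rw [tsub_eq_zero_of_le ha]
          push_cast
          nlinarith [sq_nonneg ((a : ℝ) - 1)]
      have hint := lintegral_mono (μ := P₀) hpt
      rw [lintegral_add_right _ (hg.const_mul 2), lintegral_add_left measurable_const,
        lintegral_const_mul _ hg] at hint
      have hg1 : ∫⁻ x, g x ∂P₀ = 1 := by
        have := measure_univ (μ := P₀.withDensity g)
        rwa [withDensity_apply _ MeasurableSet.univ, Measure.restrict_univ] at this
      rw [hg1, lintegral_one, measure_univ] at hint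
      have h3 := hint.trans (add_le_add_right hρ 1)
      rw [ENNReal.ofReal_add zero_le_one (sq_nonneg ε), ENNReal.ofReal_one, ← add_assoc,
        mul_one, one_add_one_eq_two, add_comm] at h3
      exact (ENNReal.add_le_add_iff_left ENNReal.ofNat_ne_top).1 h3
    have h3 := h1.trans h2
    rw [ENNReal.ofReal_pow hε.le] at h3
    exact (ENNReal.pow_le_pow_left_iff two_ne_zero).1 h3
  refine exists_contamination _ _ _ _ hadd hε ?_
  have := congrArg (fun m : Measure X => m Set.univ) hadd
  simp only [Measure.add_apply, measure_univ] at this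
  rwa [(ENNReal.add_right_inj ENNReal.one_ne_top).1 this]

end Contamination

/-! ### The size of small Hamming balls -/

section HammingBall

/-- Chernoff bound with tilt `log q`: the exponential moment factorises over letters into `(2 -
1/q)^k ≤ q^(3k/4)`, and the radius `k/8` costs `q^(k/8)`, for a total of `q^(7k/8)`. -/
theorem card_hammingDist_le {k : ℕ} {α : Type*} [Fintype α] [DecidableEq α] (q : ℝ) (hq1 : 2 ≤ q)
    (hq : (Fintype.card α : ℝ) = q) (a : Fin k → α) :
    ((Finset.univ.filter fun b : Fin k → α => 8 * hammingDist a b ≤ k).card : ℝ) ≤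
      q ^ k * Real.exp (-(k * Real.log q / 8)) := by
  have hq0 : 0 < q := by linarith
  set L := Real.log q with hL
  have hexpL : Real.exp L = q := Real.exp_log hq0
  have hpow : ∀ j : ℕ, q ^ j = Real.exp (j * L) := fun j => by rw [Real.exp_nat_mul, hexpL]
  -- exponential moment of the Hamming distance
  have hmom : ∑ b : Fin k → α, Real.exp (-(L * hammingDist a b)) = (1 + (q - 1) / q) ^ k := by
    have h1 : ∀ b : Fin k → α, Real.exp (-(L * hammingDist a b)) =
        ∏ i, (if a i = b i then 1 else q⁻¹) := by
      intro b
      rw [Finset.prod_ite]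
      simp only [Finset.prod_const_one, Finset.prod_const, one_mul]
      rw [mul_comm, ← mul_neg, Real.exp_nat_mul, Real.exp_neg, hexpL]
      rfl
    simp_rw [h1]
    rw [← Fintype.piFinset_univ, ← Finset.prod_univ_sum (fun _ => Finset.univ)
      (fun i x => if a i = x then (1 : ℝ) else q⁻¹)]
    rw [Finset.prod_congr rfl (g := fun _ => 1 + (q - 1) / q), Finset.prod_const]
    · simp
    · intro i _
      rw [Finset.sum_ite]
      have : (Finset.univ.filter fun x => a i = x) = {a i} := by ext; simp [eq_comm]
      have h2 : (Finset.univ.filter fun x => ¬ a i = x).card + 1 = Fintype.card α := by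
        have h := Finset.card_filter_add_card_filter_not (s := (Finset.univ : Finset α))
          (fun x => a i = x)
        rw [this, Finset.card_singleton, Finset.card_univ] at h
        omega
      have h3 : ((Finset.univ.filter fun x => ¬ a i = x).card : ℝ) = q - 1 := by
        rw [← hq, ← h2]; push_cast; ring
      rw [Finset.sum_const, Finset.sum_const, this, Finset.card_singleton, nsmul_eq_mul,
        nsmul_eq_mul, h3]
      simp [div_eq_mul_inv]
  have hmarkov : ((Finset.univ.filter fun b : Fin k → α => 8 * hammingDist a b ≤ k).card : ℝ) ≤
      Real.exp (L * (k / 8)) * (1 + (q - 1) / q) ^ k := by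
    rw [← hmom, Finset.mul_sum, Finset.cast_card]
    refine (Finset.sum_le_sum fun b hb => ?_).trans
      (Finset.sum_le_sum_of_subset_of_nonneg (Finset.filter_subset _ _) fun b _ _ => by positivity)
    rw [← Real.exp_add]
    refine Real.one_le_exp ?_
    have h : (8 : ℝ) * hammingDist a b ≤ k := by exact_mod_cast (Finset.mem_filter.1 hb).2
    have hL0 : 0 ≤ L := Real.log_nonneg (by linarith)
    nlinarith
  refine hmarkov.trans ?_
  have hbase : 1 + (q - 1) / q ≤ Real.exp (3 / 4 * L) := by
    have h4 : (1 + (q - 1) / q) ^ 4 ≤ q ^ 3 := by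
      have : 1 + (q - 1) / q = 2 - q⁻¹ := by field_simp; ring
      rw [this]
      -- Bounding `2 - 1/q` by `2` fails at `q = 2`, where `16 > 8`; below `13/5` the term `1/q` has
      -- to be kept.
      rcases le_total q (13 / 5) with h | h
      · have h1 : (13 / 5 : ℝ)⁻¹ ≤ q⁻¹ := inv_anti₀ hq0 h
        have h2 : q⁻¹ ≤ 1 := inv_le_one_of_one_le₀ (by linarith)
        calc (2 - q⁻¹) ^ 4 ≤ (2 - (13 / 5 : ℝ)⁻¹) ^ 4 := by gcongr; linarith
          _ ≤ 2 ^ 3 := by norm_num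
          _ ≤ q ^ 3 := by gcongr
      · have h2 : q⁻¹ ≤ 1 := inv_le_one_of_one_le₀ (by linarith)
        have h3 : 0 < q⁻¹ := inv_pos.2 hq0
        calc (2 - q⁻¹) ^ 4 ≤ 2 ^ 4 := by gcongr <;> linarith
          _ ≤ (13 / 5) ^ 3 := by norm_num
          _ ≤ q ^ 3 := by gcongr
    refine le_of_pow_le_pow_left₀ four_ne_zero (Real.exp_pos _).le (h4.trans_eq ?_)
    rw [← Real.exp_nat_mul, hpow]
    congr 1; push_cast; ring
  calc Real.exp (L * (k / 8)) * (1 + (q - 1) / q) ^ k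
      ≤ Real.exp (L * (k / 8)) * Real.exp (3 / 4 * L) ^ k := by
        gcongr
        have : 0 ≤ (q - 1) / q := div_nonneg (by linarith) hq0.le
        linarith
    _ = q ^ k * Real.exp (-(k * L / 8)) := by
        rw [hpow, ← Real.exp_nat_mul, ← Real.exp_add, ← Real.exp_add]
        congr 1; ring

end HammingBall

/-! ### Frobenius geometry of the loss -/

section Loss

theorem fnorm_sub_le_add {p q : ℕ} (A B C : Matrix (Fin p) (Fin q) ℝ) :
    fnorm (B - C) ≤ fnorm (A - B) + fnorm (A - C) := by
  let _ := @frobeniusNormedAddCommGroup (Fin p) (Fin q) ℝ _ _ _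
  have h : ∀ E : Matrix (Fin p) (Fin q) ℝ, fnorm E = ‖E‖ := fun E => by
    rw [frobenius_norm_def, fnorm, Real.sqrt_eq_rpow]
    simp
  rw [h, h, h, norm_sub_rev A B]
  exact norm_sub_le_norm_sub_add_norm_sub B A C

theorem fnorm_sub_sq_lt {p q : ℕ} {A B C : Matrix (Fin p) (Fin q) ℝ} {t : ℝ}
    (hB : fnorm (A - B) ^ 2 < t) (hC : fnorm (A - C) ^ 2 < t) : fnorm (B - C) ^ 2 < 4 * t := by
  have h := fnorm_sub_le_add A B C
  have h0 : 0 ≤ fnorm (B - C) := Real.sqrt_nonneg _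
  nlinarith [sq_nonneg (fnorm (A - B) - fnorm (A - C))]

theorem fnorm_sq {p q : ℕ} (A : Matrix (Fin p) (Fin q) ℝ) :
    fnorm A ^ 2 = ∑ i, ∑ j, A i j ^ 2 :=
  Real.sq_sqrt (Finset.sum_nonneg fun _ _ => Finset.sum_nonneg fun _ _ => sq_nonneg _)

theorem fnorm_vecMulVec_sub_sq {p : ℕ} {v w : Fin p → ℝ} (hv : v ⬝ᵥ v = 1) (hw : w ⬝ᵥ w = 1) :
    fnorm (vecMulVec v v - vecMulVec w w) ^ 2 = 2 * (1 - (v ⬝ᵥ w) ^ 2) := by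
  rw [fnorm_sq]
  have h : ∀ i j, (vecMulVec v v - vecMulVec w w) i j ^ 2 =
      (v i * v i) * (v j * v j) - 2 * ((v i * w i) * (v j * w j)) + (w i * w i) * (w j * w j) := by
    intro i j
    change (v i * v j - w i * w j) ^ 2 = _
    ring
  simp_rw [h, Finset.sum_add_distrib, Finset.sum_sub_distrib, ← Finset.mul_sum, ← Finset.sum_mul]
  simp only [dotProduct] at *
  rw [hv, hw]
  ring

end Loss

/-! ### The family of rotated sparse spikes -/

section Model

variable {p r k m : ℕ} (ι : Fin (r + 1) ⊕ (Fin k × Fin m) ↪ Fin p)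

/-- The sign attached to a letter. -/
def letterSign (b : Bool) : ℝ := if b then 1 else -1

/-- The unit vector with one entry `±1/√k` in each of `k` blocks, at the positions and with the
signs given by the word `θ`. -/
noncomputable def sparseDir (θ : Fin k → Fin m × Bool) : Fin p → ℝ :=
  ∑ b, (letterSign (θ b).2 / Real.sqrt k) • Pi.single (ι (Sum.inr (b, (θ b).1))) 1

/-- The direction of the last spike before rotation. -/
noncomputable def baseDir : Fin p → ℝ := Pi.single (ι (Sum.inl (Fin.last r))) 1

/-- The coordinate vectors of the common spikes, as columns. -/
noncomputable def commonFrame : Matrix (Fin p) (Fin r) ℝ :=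
  of fun i j => (Pi.single (ι (Sum.inl j.castSucc)) 1 : Fin p → ℝ) i

/-- The frame consisting of the common spikes and of `w`. -/
noncomputable def frame (w : Fin p → ℝ) : Matrix (Fin p) (Fin (r + 1)) ℝ :=
  of fun i j => Fin.snoc (α := fun _ => ℝ) (fun j => commonFrame ι i j) (w i) j

theorem single_dotProduct_single_one (i j : Fin p) :
    (Pi.single i 1 : Fin p → ℝ) ⬝ᵥ Pi.single j 1 = if i = j then 1 else 0 := by
  rw [single_dotProduct, one_mul, Pi.single_apply]

theorem sparseDir_dotProduct (θ θ' : Fin k → Fin m × Bool) :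
    sparseDir ι θ ⬝ᵥ sparseDir ι θ' =
      ∑ b, if (θ b).1 = (θ' b).1 then letterSign (θ b).2 * letterSign (θ' b).2 / k else 0 := by
  rw [sparseDir, sparseDir, sum_dotProduct]
  refine Finset.sum_congr rfl fun b _ => ?_
  rw [dotProduct_sum, Finset.sum_eq_single b]
  · rw [smul_dotProduct, dotProduct_smul, single_dotProduct_single_one]
    have hk := Real.mul_self_sqrt (Nat.cast_nonneg (α := ℝ) k)
    by_cases h : (θ b).1 = (θ' b).1
    · simp only [h, if_true, smul_eq_mul, mul_one]
      rw [div_mul_div_comm, hk]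
    · simp [h]
  · intro b' _ hb
    rw [smul_dotProduct, dotProduct_smul, single_dotProduct_single_one, if_neg]
    · simp
    · simp [hb.symm]
  · simp

theorem sparseDir_dotProduct_self (hk : 0 < k) (θ : Fin k → Fin m × Bool) :
    sparseDir ι θ ⬝ᵥ sparseDir ι θ = 1 := by
  rw [sparseDir_dotProduct]
  have : ∀ b : Bool, letterSign b * letterSign b = 1 := by intro b; cases b <;> simp [letterSign]
  have hk' : (k : ℝ) ≠ 0 := by positivity
  simp [this, hk']

/-- Agreeing letters contribute `1/k`. A disagreement contributes `0` if the positions differ and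
`-1/k` if only the signs differ. -/
theorem sparseDir_dotProduct_le (hk : 0 < k) (θ θ' : Fin k → Fin m × Bool) :
    sparseDir ι θ ⬝ᵥ sparseDir ι θ' ≤ 1 - hammingDist θ θ' / k := by
  have hk' : (0 : ℝ) < k := by positivity
  have h1 : (hammingDist θ θ' : ℝ) / k = ∑ b, if θ b ≠ θ' b then 1 / (k : ℝ) else 0 := by
    rw [Finset.sum_ite]
    simp [hammingDist, div_eq_mul_inv]
  have h2 : (1 : ℝ) = ∑ _b : Fin k, 1 / (k : ℝ) := by simp [hk'.ne']
  rw [sparseDir_dotProduct, h1]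
  refine le_trans ?_ (sub_le_sub_right h2.ge _)
  rw [← Finset.sum_sub_distrib]
  refine Finset.sum_le_sum fun b _ => ?_
  by_cases h : θ b = θ' b
  · have : ∀ b : Bool, letterSign b * letterSign b = 1 := by intro b; cases b <;> simp [letterSign]
    simp [h, this]
  · simp only [ne_eq, h, not_false_iff, if_true, sub_self]
    by_cases h' : (θ b).1 = (θ' b).1
    · have h3 : (θ b).2 ≠ (θ' b).2 := fun h3 => h (Prod.ext h' h3)
      have : letterSign (θ b).2 * letterSign (θ' b).2 = -1 := by
        revert h3
        cases (θ b).2 <;> cases (θ' b).2 <;> simp [letterSign]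
      rw [if_pos h', this]
      exact div_nonpos_of_nonpos_of_nonneg (by norm_num) hk'.le
    · rw [if_neg h']

theorem baseDir_dotProduct_self : baseDir ι ⬝ᵥ baseDir ι = 1 := by
  simp [baseDir]

theorem baseDir_dotProduct_sparseDir (θ : Fin k → Fin m × Bool) :
    baseDir ι ⬝ᵥ sparseDir ι θ = 0 := by
  rw [sparseDir, dotProduct_sum]
  refine Finset.sum_eq_zero fun b _ => ?_
  rw [dotProduct_smul, baseDir, single_dotProduct_single_one]
  simp

theorem commonFrame_transpose_mul : (commonFrame ι)ᵀ * commonFrame ι = 1 := by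
  ext i j
  rw [mul_apply]
  have := single_dotProduct_single_one (ι (Sum.inl i.castSucc)) (ι (Sum.inl j.castSucc))
  simp only [dotProduct] at this
  simp only [transpose_apply, commonFrame, of_apply, this]
  simp [one_apply]

/-- The projection on the common spikes. -/
noncomputable def commonProj : Matrix (Fin p) (Fin p) ℝ := commonFrame ι * (commonFrame ι)ᵀ

theorem commonProj_mul_self : commonProj ι * commonProj ι = commonProj ι := by
  rw [commonProj, Matrix.mul_assoc, ← Matrix.mul_assoc _ (commonFrame ι), commonFrame_transpose_mul,
    Matrix.one_mul]

theorem commonProj_transpose : (commonProj ι)ᵀ = commonProj ι := by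
  rw [commonProj, transpose_mul, transpose_transpose]

theorem commonFrame_transpose_mulVec_baseDir : (commonFrame ι)ᵀ *ᵥ baseDir ι = 0 := by
  ext j
  have := single_dotProduct_single_one (ι (Sum.inl j.castSucc)) (ι (Sum.inl (Fin.last r)))
  rw [mulVec]
  refine this.trans ?_
  simp [Fin.castSucc_ne_last]

theorem commonFrame_transpose_mulVec_sparseDir (θ : Fin k → Fin m × Bool) :
    (commonFrame ι)ᵀ *ᵥ sparseDir ι θ = 0 := by
  rw [sparseDir, mulVec_sum]
  refine Finset.sum_eq_zero fun b _ => ?_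
  ext j
  have := single_dotProduct_single_one (ι (Sum.inl j.castSucc)) (ι (Sum.inr (b, (θ b).1)))
  rw [mulVec_smul, Pi.smul_apply, mulVec]
  refine (congrArg _ this).trans ?_
  simp

theorem commonProj_mulVec_baseDir : commonProj ι *ᵥ baseDir ι = 0 := by
  rw [commonProj, ← mulVec_mulVec, commonFrame_transpose_mulVec_baseDir, mulVec_zero]

theorem commonProj_mulVec_sparseDir (θ : Fin k → Fin m × Bool) :
    commonProj ι *ᵥ sparseDir ι θ = 0 := by
  rw [commonProj, ← mulVec_mulVec, commonFrame_transpose_mulVec_sparseDir, mulVec_zero]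

theorem frame_mul_transpose (w : Fin p → ℝ) :
    frame ι w * (frame ι w)ᵀ = commonProj ι + vecMulVec w w := by
  ext i j
  simp [mul_apply, frame, Fin.sum_univ_castSucc, commonProj, vecMulVec_apply]

theorem isOrthonormal_frame {w : Fin p → ℝ} (hw : (commonFrame ι)ᵀ *ᵥ w = 0) (hww : w ⬝ᵥ w = 1) :
    IsOrthonormal (frame ι w) := by
  have hw' : ∀ j, ∑ i, commonFrame ι i j * w i = 0 := fun j => congrFun hw j
  have hw'' : ∀ j, ∑ i, w i * commonFrame ι i j = 0 := fun j => by simp_rw [mul_comm (w _), hw']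
  have hc : ∀ j j', ∑ i, commonFrame ι i j * commonFrame ι i j' = if j = j' then 1 else 0 :=
    fun j j' => (congrFun (congrFun (commonFrame_transpose_mul ι) j) j').trans one_apply
  rw [dotProduct] at hww
  ext j j'
  rw [mul_apply]
  simp only [transpose_apply, frame, of_apply]
  refine Fin.lastCases ?_ (fun j => ?_) j <;> refine Fin.lastCases ?_ (fun j' => ?_) j'
  · simp [hww]
  · simp [hw'', one_apply, (Fin.castSucc_ne_last _).symm]
  · simp [hw', one_apply, Fin.castSucc_ne_last]
  · simp [hc, one_apply]

/-- The rotated direction of the last spike. -/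
noncomputable def spikeDir (c s : ℝ) (θ : Fin k → Fin m × Bool) : Fin p → ℝ :=
  c • baseDir ι + s • sparseDir ι θ

variable {c s : ℝ}

theorem spikeDir_dotProduct (θ θ' : Fin k → Fin m × Bool) :
    spikeDir ι c s θ ⬝ᵥ spikeDir ι c s θ' = c ^ 2 + s ^ 2 * (sparseDir ι θ ⬝ᵥ sparseDir ι θ') := by
  simp only [spikeDir, add_dotProduct, dotProduct_add, smul_dotProduct, dotProduct_smul,
    baseDir_dotProduct_self, baseDir_dotProduct_sparseDir, dotProduct_comm (sparseDir ι θ) (baseDir ι),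
    smul_eq_mul]
  ring

theorem spikeDir_dotProduct_self (hk : 0 < k) (hcs : c ^ 2 + s ^ 2 = 1) (θ : Fin k → Fin m × Bool) :
    spikeDir ι c s θ ⬝ᵥ spikeDir ι c s θ = 1 := by
  rw [spikeDir_dotProduct ι, sparseDir_dotProduct_self ι hk, mul_one, hcs]

theorem commonFrame_transpose_mulVec_spikeDir (θ : Fin k → Fin m × Bool) :
    (commonFrame ι)ᵀ *ᵥ spikeDir ι c s θ = 0 := by
  rw [spikeDir, mulVec_add, mulVec_smul, mulVec_smul, commonFrame_transpose_mulVec_baseDir,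
    commonFrame_transpose_mulVec_sparseDir]
  simp

theorem rowSupport_frame_subset (θ : Fin k → Fin m × Bool) :
    rowSupport (frame ι (spikeDir ι c s θ)) ⊆
      ((Finset.univ.image fun j : Fin (r + 1) => ι (Sum.inl j)) ∪
        Finset.univ.image fun b : Fin k => ι (Sum.inr (b, (θ b).1)) : Finset (Fin p)) := by
  rintro i ⟨j, hj⟩
  by_contra hi
  simp only [Finset.coe_union, Finset.coe_image, Finset.coe_univ, Set.image_univ, Set.mem_union,
    Set.mem_range, not_or, not_exists] at hi
  refine hj ?_
  have h1 : ∀ j, i ≠ ι (Sum.inl j) := fun j h => hi.1 j h.symm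
  have h2 : ∀ b, i ≠ ι (Sum.inr (b, (θ b).1)) := fun b h => hi.2 b h.symm
  simp only [frame, of_apply]
  refine Fin.lastCases ?_ (fun j => ?_) j
  · simp [spikeDir, baseDir, sparseDir, h1, h2]
  · simp [commonFrame, Pi.single_apply, h1]

theorem isSparseSpiked_frame (hk : 0 < k) (hcs : c ^ 2 + s ^ 2 = 1) (θ : Fin k → Fin m × Bool)
    {σ : ℕ} (hσ : r + 1 + k ≤ σ) {lam M : ℝ} (hM : lam ≤ M) :
    IsSparseSpiked σ lam M (frame ι (spikeDir ι c s θ)) fun _ => lam where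
  orthonormal := isOrthonormal_frame ι (commonFrame_transpose_mulVec_spikeDir ι θ)
    (spikeDir_dotProduct_self ι hk hcs θ)
  support_le := by
    refine (Set.ncard_le_ncard (rowSupport_frame_subset ι θ) (Finset.finite_toSet _)).trans ?_
    rw [Set.ncard_coe_finset]
    refine (Finset.card_union_le _ _).trans (le_trans ?_ hσ)
    refine add_le_add (Finset.card_image_le.trans ?_) (Finset.card_image_le.trans ?_) <;> simp
  antitone := antitone_const
  lower := fun _ => le_rfl
  upper := fun _ => hM

theorem spikedCov_frame (w : Fin p → ℝ) (lam : ℝ) :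
    spikedCov (frame ι w) (fun _ => lam) = lam • (commonProj ι + vecMulVec w w) + 1 := by
  rw [spikedCov, ← frame_mul_transpose, ← smul_one_eq_diagonal, Matrix.mul_smul, Matrix.mul_one,
    Matrix.smul_mul]

/-- Two rotated spikes are separated by the Hamming distance of their words. -/
theorem hammingDist_le_of_fnorm_lt (hk : 0 < k) (hcs : c ^ 2 + s ^ 2 = 1) (hs0 : s ≠ 0)
    (hs : s ^ 2 ≤ 1 / 2) (θ θ' : Fin k → Fin m × Bool)
    (h : fnorm (frame ι (spikeDir ι c s θ) * (frame ι (spikeDir ι c s θ))ᵀ -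
      frame ι (spikeDir ι c s θ') * (frame ι (spikeDir ι c s θ'))ᵀ) ^ 2 < s ^ 2 / 4) :
    8 * hammingDist θ θ' ≤ k := by
  rw [frame_mul_transpose, frame_mul_transpose, add_sub_add_left_eq_sub,
    fnorm_vecMulVec_sub_sq (spikeDir_dotProduct_self ι hk hcs θ)
      (spikeDir_dotProduct_self ι hk hcs θ'), spikeDir_dotProduct ι] at h
  have hle := sparseDir_dotProduct_le ι hk θ θ'
  have hge : -1 ≤ sparseDir ι θ ⬝ᵥ sparseDir ι θ' := by
    have h1 := dotProduct_self_nonneg_real (sparseDir ι θ + sparseDir ι θ')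
    simp only [add_dotProduct, dotProduct_add, sparseDir_dotProduct_self ι hk,
      dotProduct_comm (sparseDir ι θ') (sparseDir ι θ)] at h1
    linarith
  generalize sparseDir ι θ ⬝ᵥ sparseDir ι θ' = a at *
  have hk' : (0 : ℝ) < k := by exact_mod_cast hk
  have hs2 : 0 < s ^ 2 := by positivity
  -- The loss is `2x(2 - x)` with `x = s²(1 - a)`. Since `a ≥ -1` and `s² ≤ 1/2`, `x ≤ 1`, so the
  -- loss is at least `2x`.
  have ha : 1 - a ≤ 1 / 8 := by
    have e : 1 - (c ^ 2 + s ^ 2 * a) ^ 2 = s ^ 2 * (1 - a) * (2 - s ^ 2 * (1 - a)) := by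
      rw [show c ^ 2 = 1 - s ^ 2 by linarith]; ring
    rw [e] at h
    have h0 : 0 ≤ (hammingDist θ θ' : ℝ) / k := by positivity
    have h1 : 1 ≤ 2 - s ^ 2 * (1 - a) := by nlinarith
    have h2 : s ^ 2 * (1 - a) ≤ s ^ 2 * (1 - a) * (2 - s ^ 2 * (1 - a)) :=
      le_mul_of_one_le_right (mul_nonneg hs2.le (by linarith)) h1
    nlinarith
  have h3 : (hammingDist θ θ' : ℝ) / k ≤ 1 / 8 := by linarith
  rw [div_le_iff₀ hk'] at h3
  have : (8 : ℝ) * hammingDist θ θ' ≤ k := by linarith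
  exact_mod_cast this

end Model

/-! ### Elementary properties of the minimax probability -/

section Minimax

theorem le_minimaxProb {n p r s : ℕ} {lam M ε t : ℝ} {a : ℝ≥0∞}
    (h : ∀ Vhat ∈ estimators n p r, ∃ V ℓ, IsSparseSpiked s lam M V ℓ ∧
      ∃ Q, a ≤ sampleLaw n ε (spikedCov V ℓ) Q (lossEvent Vhat V t)) :
    a ≤ minimaxProb n p r s lam M ε t := by
  refine le_iInf₂ fun Vhat hV => ?_
  obtain ⟨V, ℓ, hS, Q, hQ⟩ := h Vhat hV
  exact hQ.trans <| le_iSup_of_le V <| le_iSup_of_le ℓ <| le_iSup_of_le hS <| le_iSup_of_le Q le_rfl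

theorem lossEvent_anti {n p r : ℕ}
    (Vhat : (Fin n → EuclideanSpace ℝ (Fin p)) → Matrix (Fin p) (Fin r) ℝ)
    (V : Matrix (Fin p) (Fin r) ℝ) {t t' : ℝ} (h : t ≤ t') :
    lossEvent Vhat V t' ⊆ lossEvent Vhat V t := fun _ hx => h.trans hx

theorem minimaxProb_anti {n p r s : ℕ} {lam M ε t t' : ℝ} (h : t ≤ t') :
    minimaxProb n p r s lam M ε t' ≤ minimaxProb n p r s lam M ε t :=
  iInf₂_mono fun Vhat _ => iSup_mono fun V => iSup_mono fun _ => iSup_mono fun _ =>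
    iSup_mono fun _ => measure_mono (lossEvent_anti Vhat V h)

theorem measurableSet_lossEvent {n p r : ℕ}
    {Vhat : (Fin n → EuclideanSpace ℝ (Fin p)) → Matrix (Fin p) (Fin r) ℝ}
    (hV : Vhat ∈ estimators n p r) (V : Matrix (Fin p) (Fin r) ℝ) (t : ℝ) :
    MeasurableSet (lossEvent Vhat V t) := by
  have h : ∀ i j, Measurable fun x => (Vhat x * (Vhat x)ᵀ) i j := hV.2
  have hf : Measurable fun x => fnorm (Vhat x * (Vhat x)ᵀ - V * Vᵀ) ^ 2 := by
    simp only [fnorm_sq]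
    exact Finset.measurable_sum _ fun i _ => Finset.measurable_sum _ fun j _ =>
      ((h i j).sub_const _).pow_const 2
  exact measurableSet_le measurable_const hf

/-- The centred Gaussian law as a probability measure. -/
noncomputable def gaussLaw {p : ℕ} (S : Matrix (Fin p) (Fin p) ℝ) :
    ProbabilityMeasure (EuclideanSpace ℝ (Fin p)) :=
  ⟨multivariateGaussian 0 S, inferInstance⟩

/-- Contaminating a law by itself changes nothing, so a bound for uncontaminated samples serves for
every `ε`. -/
theorem contaminated_self {p : ℕ} {ε : ℝ} (hε0 : 0 ≤ ε) (hε1 : ε ≤ 1)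
    (S : Matrix (Fin p) (Fin p) ℝ) :
    contaminated ε S (gaussLaw S) = multivariateGaussian 0 S := by
  rw [contaminated, gaussLaw, ProbabilityMeasure.coe_mk, ← add_smul,
    ← ENNReal.ofReal_add (by linarith) hε0]
  simp

end Minimax

/-! ### The two lower bounds -/

section LowerBounds

variable {n p r k m : ℕ} (ι : Fin (r + 1) ⊕ (Fin k × Fin m) ↪ Fin p) {c s lam : ℝ}

theorem posDef_frame (hk : 0 < k) (hlam : 0 ≤ lam) (hcs : c ^ 2 + s ^ 2 = 1)
    (θ : Fin k → Fin m × Bool) :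
    (spikedCov (frame ι (spikeDir ι c s θ)) fun _ => lam).PosDef := by
  rw [spikedCov_frame, ← frame_mul_transpose]
  have hV : (frame ι (spikeDir ι c s θ))ᵀ * frame ι (spikeDir ι c s θ) = 1 :=
    isOrthonormal_frame ι (commonFrame_transpose_mulVec_spikeDir ι θ)
      (spikeDir_dotProduct_self ι hk hcs θ)
  refine posDef_spiked hlam ?_ (by rw [transpose_mul, transpose_transpose])
  rw [Matrix.mul_assoc, ← Matrix.mul_assoc _ (frame ι _), hV, Matrix.one_mul]

theorem spikeDir_one_zero (θ : Fin k → Fin m × Bool) : spikeDir ι 1 0 θ = baseDir ι := by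
  simp [spikeDir]

theorem lintegral_gaussRatio_sq_frame (hk : 0 < k) (hlam : 0 ≤ lam) (hcs : c ^ 2 + s ^ 2 = 1)
    (hs : 2 * lam * s ^ 2 < 1) (hs' : 4 * lam ^ 2 * s ^ 2 ≤ 1) (θ θ' : Fin k → Fin m × Bool) :
    ∫⁻ x, gaussRatio (spikedCov (frame ι (spikeDir ι 1 0 θ')) fun _ => lam)
        (spikedCov (frame ι (spikeDir ι c s θ)) fun _ => lam) x ^ 2
        ∂(multivariateGaussian 0 (spikedCov (frame ι (spikeDir ι 1 0 θ')) fun _ => lam)) ≤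
      ENNReal.ofReal (Real.exp (2 * lam ^ 2 * s ^ 2)) := by
  rw [spikedCov_frame, spikedCov_frame, spikeDir_one_zero]
  exact lintegral_gaussRatio_sq_spiked hlam (commonProj_mul_self ι) (commonProj_transpose ι)
    (commonProj_mulVec_baseDir ι) (baseDir_dotProduct_self ι) (commonProj_mulVec_sparseDir ι θ)
    (sparseDir_dotProduct_self ι hk θ) (baseDir_dotProduct_sparseDir ι θ) hcs hs hs'

theorem exists_frame_loss_of_sparsity (hk : 0 < k) (hm : 0 < m) (hlam : 0 ≤ lam)
    (hcs : c ^ 2 + s ^ 2 = 1) (hs0 : s ≠ 0) (hs1 : s ^ 2 ≤ 1 / 2) (hs : 2 * lam * s ^ 2 < 1)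
    (hs' : 4 * lam ^ 2 * s ^ 2 ≤ 1)
    (hbudget : 32 * (n * lam ^ 2) * s ^ 2 ≤ k * Real.log (2 * m)) {ε : ℝ} (hε0 : 0 ≤ ε)
    (hε1 : ε ≤ 1) {Vhat : (Fin n → EuclideanSpace ℝ (Fin p)) → Matrix (Fin p) (Fin (r + 1)) ℝ}
    (hV : Vhat ∈ estimators n p (r + 1)) :
    ∃ θ, ∃ Q, ENNReal.ofReal (1 - Real.exp (-(Real.log 2 / 32))) ≤
      sampleLaw n ε (spikedCov (frame ι (spikeDir ι c s θ)) fun _ => lam) Q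
        (lossEvent Vhat (frame ι (spikeDir ι c s θ)) (s ^ 2 / 16)) := by
  classical
  have : NeZero m := ⟨hm.ne'⟩
  let θ₀ : Fin k → Fin m × Bool := fun _ => (0, true)
  let S : (Fin k → Fin m × Bool) → Matrix (Fin p) (Fin p) ℝ := fun θ =>
    spikedCov (frame ι (spikeDir ι c s θ)) fun _ => lam
  let S₀ : Matrix (Fin p) (Fin p) ℝ := spikedCov (frame ι (spikeDir ι 1 0 θ₀)) fun _ => lam
  have h₀ : S₀.PosDef := posDef_frame ι hk hlam (by norm_num) θ₀
  have h₁ : ∀ θ, (S θ).PosDef := posDef_frame ι hk hlam hcs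
  let A : (Fin k → Fin m × Bool) → Set (Fin n → EuclideanSpace ℝ (Fin p)) := fun θ =>
    (lossEvent Vhat (frame ι (spikeDir ι c s θ)) (s ^ 2 / 16))ᶜ
  have hA : ∀ θ, MeasurableSet (A θ) := fun θ => (measurableSet_lossEvent hV _ _).compl
  have hm' : (1 : ℝ) ≤ m := by exact_mod_cast hm
  have hq : (Fintype.card (Fin m × Bool) : ℝ) = 2 * m := by
    simp [mul_comm]
  set q : ℝ := 2 * m with hqdef
  have hq2 : 2 ≤ q := by linarith
  set L := Real.log q with hL
  obtain ⟨θ, hθ⟩ := exists_measure_le_of_card_le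
    (Measure.pi fun _ : Fin n => multivariateGaussian 0 S₀) A hA
    (q ^ k * Real.exp (-(k * L / 8))) (by
      intro x
      rcases Set.eq_empty_or_nonempty {θ | x ∈ A θ} with h | ⟨θ₁, hθ₁⟩
      · rw [h, Set.ncard_empty]; push_cast; positivity
      -- Two words both estimated within `s²/16` at `x` have projections within `4 · s²/16 = s²/4`,
      -- hence all such words lie in the Hamming ball around any one of them.
      · refine le_trans ?_ (card_hammingDist_le q hq2 hq θ₁)
        rw [← Set.ncard_coe_finset]
        refine Nat.cast_le.2 (Set.ncard_le_ncard (fun θ₂ hθ₂ => ?_) (Finset.finite_toSet _))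
        simp only [Finset.coe_filter, Finset.mem_univ, true_and, Set.mem_ofPred_eq]
        refine hammingDist_le_of_fnorm_lt ι hk hcs hs0 hs1 θ₁ θ₂ ?_
        have := fnorm_sub_sq_lt (not_le.1 hθ₁) (not_le.1 hθ₂)
        linarith)
  refine ⟨θ, gaussLaw (S θ), ?_⟩
  have hlaw : sampleLaw n ε (S θ) (gaussLaw (S θ)) =
      Measure.pi fun _ : Fin n => multivariateGaussian 0 (S θ) := by
    rw [sampleLaw, contaminated_self hε0 hε1]
  have hcard : (Fintype.card (Fin k → Fin m × Bool) : ℝ) = q ^ k := by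
    rw [Fintype.card_fun, Fintype.card_fin]; push_cast; rw [hq]
  rw [hcard, mul_div_cancel_left₀ _ (by positivity)] at hθ
  have hgr := multivariateGaussian_withDensity_gaussRatio h₀ (h₁ θ)
  have hpr : IsProbabilityMeasure
      ((multivariateGaussian 0 S₀).withDensity (gaussRatio S₀ (S θ))) := by
    rw [hgr]; infer_instance
  have hsq := sq_pi_withDensity_le (n := n) (multivariateGaussian 0 S₀)
    (measurable_gaussRatio S₀ (S θ)) (A θ)
  rw [hgr] at hsq
  have hρ := lintegral_gaussRatio_sq_frame ι hk hlam hcs hs hs' θ θ₀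
  have hL2 : Real.log 2 ≤ L := Real.log_le_log two_pos hq2
  have hlog2 : 0 < Real.log 2 := Real.log_pos one_lt_two
  have hk1 : (1 : ℝ) ≤ k := by exact_mod_cast hk
  -- The squared probability has exponent at most `2n lam² s² - kL/8 ≤ kL/16 - kL/8 = -kL/16`, and
  -- `kL ≥ log 2`; halving the exponent gives `log 2 / 32`.
  have hsmall : (Measure.pi fun _ : Fin n => multivariateGaussian 0 (S θ)) (A θ) ≤
      ENNReal.ofReal (Real.exp (-(Real.log 2 / 32))) := by
    rw [← ENNReal.pow_le_pow_left_iff two_ne_zero]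
    refine hsq.trans ((mul_le_mul' (pow_le_pow_left' hρ n) hθ).trans ?_)
    rw [← ENNReal.ofReal_pow (Real.exp_pos _).le, ← ENNReal.ofReal_pow (Real.exp_pos _).le,
      ← ENNReal.ofReal_mul (by positivity), ← Real.exp_nat_mul, ← Real.exp_nat_mul, ← Real.exp_add]
    refine ENNReal.ofReal_le_ofReal (Real.exp_le_exp.2 ?_)
    push_cast
    nlinarith
  rw [hlaw]
  have hcompl : lossEvent Vhat (frame ι (spikeDir ι c s θ)) (s ^ 2 / 16) = (A θ)ᶜ :=
    (compl_compl _).symm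
  rw [hcompl, prob_compl_eq_one_sub (hA θ), ENNReal.ofReal_sub _ (Real.exp_pos _).le,
    ENNReal.ofReal_one]
  exact tsub_le_tsub_left hsmall 1

/-- Two-point argument with indistinguishable hypotheses: under the common law the two loss events
cover the sample space, so one has probability at least `1/2`. The pair `c', s'` is either `1, 0` or
`c, s`. -/
theorem exists_frame_loss_of_contamination (hk : 0 < k) (hlam : 0 ≤ lam)
    (hcs : c ^ 2 + s ^ 2 = 1) (hs0 : s ≠ 0) (hs : 2 * lam * s ^ 2 < 1)
    (hs' : 4 * lam ^ 2 * s ^ 2 ≤ 1) {ε : ℝ} (hε0 : 0 < ε) (hε1 : ε ≤ 1)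
    (hbudget : 4 * lam ^ 2 * s ^ 2 ≤ ε ^ 2) (θ : Fin k → Fin m × Bool)
    (Vhat : (Fin n → EuclideanSpace ℝ (Fin p)) → Matrix (Fin p) (Fin (r + 1)) ℝ) :
    ∃ c' s' : ℝ, c' ^ 2 + s' ^ 2 = 1 ∧ ∃ Q, ENNReal.ofReal (1 / 2) ≤
      sampleLaw n ε (spikedCov (frame ι (spikeDir ι c' s' θ)) fun _ => lam) Q
        (lossEvent Vhat (frame ι (spikeDir ι c' s' θ)) (s ^ 2 / 16)) := by
  set V₀ := frame ι (spikeDir ι 1 0 θ) with hV₀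
  set V₁ := frame ι (spikeDir ι c s θ) with hV₁
  have h₀ : (spikedCov V₀ fun _ => lam).PosDef := posDef_frame ι hk hlam (by norm_num) θ
  have h₁ : (spikedCov V₁ fun _ => lam).PosDef := posDef_frame ι hk hlam hcs θ
  have hρ := lintegral_gaussRatio_sq_frame ι hk hlam hcs hs hs' θ θ
  rw [← hV₀, ← hV₁] at hρ
  generalize hS₀ : (spikedCov V₀ fun _ => lam) = S₀ at *
  generalize hS₁ : (spikedCov V₁ fun _ => lam) = S₁ at *
  have hgr := multivariateGaussian_withDensity_gaussRatio h₀ h₁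
  have hpr : IsProbabilityMeasure
      ((multivariateGaussian 0 S₀).withDensity (gaussRatio S₀ S₁)) := by
    rw [hgr]; infer_instance
  obtain ⟨Q₀, Q₁, hQ⟩ := exists_contamination_of_density (multivariateGaussian 0 S₀)
    (measurable_gaussRatio S₀ S₁) (fun _ => ENNReal.ofReal_ne_top) hε0
    (hρ.trans (ENNReal.ofReal_le_ofReal (by
      set y := 2 * lam ^ 2 * s ^ 2 with hy
      have hy0 : 0 ≤ y := by positivity
      -- For `y ≤ 1/2`, `exp y ≤ 1 + 2y`, and `2y = 4 lam² s² ≤ ε²`.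
      have h1 := Real.exp_bound' hy0 (by linarith) (n := 2) two_pos
      norm_num [Finset.sum_range_succ, Nat.factorial] at h1
      nlinarith)))
  rw [hgr] at hQ
  have hlaw : sampleLaw n ε S₀ Q₀ = sampleLaw n ε S₁ Q₁ := by
    simp only [sampleLaw, contaminated, hQ]
  have hc : IsProbabilityMeasure (contaminated ε S₀ Q₀) := ⟨by
    simp only [contaminated, Measure.add_apply, Measure.smul_apply, measure_univ, smul_eq_mul,
      mul_one]
    rw [← ENNReal.ofReal_add (by linarith) hε0.le]
    simp⟩
  have hprob : IsProbabilityMeasure (sampleLaw n ε S₀ Q₀) := by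
    unfold sampleLaw; infer_instance
  set t := s ^ 2 / 16
  have hcover : Set.univ ⊆ lossEvent Vhat V₀ t ∪ lossEvent Vhat V₁ t := by
    intro x _
    by_contra hx
    simp only [Set.mem_union, not_or] at hx
    -- The squared distance of the two projections is `2(1 - c²) = 2s²`, which exceeds `4t = s²/4`.
    have h := fnorm_sub_sq_lt (not_le.1 hx.1) (not_le.1 hx.2)
    rw [hV₀, hV₁, frame_mul_transpose, frame_mul_transpose, add_sub_add_left_eq_sub,
      fnorm_vecMulVec_sub_sq (spikeDir_dotProduct_self ι hk (by norm_num) θ)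
        (spikeDir_dotProduct_self ι hk hcs θ), spikeDir_one_zero, spikeDir, dotProduct_add,
      dotProduct_smul, dotProduct_smul, baseDir_dotProduct_self, baseDir_dotProduct_sparseDir] at h
    have : 0 < s ^ 2 := by positivity
    simp only [smul_eq_mul, mul_one, mul_zero, add_zero, t] at h
    linarith
  have hsum : 1 ≤ sampleLaw n ε S₀ Q₀ (lossEvent Vhat V₀ t) +
      sampleLaw n ε S₀ Q₀ (lossEvent Vhat V₁ t) := by
    rw [← measure_univ (μ := sampleLaw n ε S₀ Q₀)]
    exact (measure_mono hcover).trans (measure_union_le _ _)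
  have hhalf : ENNReal.ofReal (1 / 2) + ENNReal.ofReal (1 / 2) = 1 := by
    rw [← ENNReal.ofReal_add (by norm_num) (by norm_num)]; norm_num
  by_cases hlt : ENNReal.ofReal (1 / 2) ≤ sampleLaw n ε S₀ Q₀ (lossEvent Vhat V₀ t)
  · refine ⟨1, 0, by norm_num, Q₀, ?_⟩
    rw [← hV₀, hS₀]
    exact hlt
  · refine ⟨c, s, hcs, Q₁, ?_⟩
    rw [← hV₁, hS₁, ← hlaw]
    by_contra hlt'
    exact absurd (hsum.trans_lt (ENNReal.add_lt_add (not_le.1 hlt) (not_le.1 hlt'))) (by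
      rw [hhalf]; exact lt_irrefl _)

end LowerBounds

/-! ### Matching the rates and choosing the constants -/

/-- Compares the target rate with the log-number of words. It rests on `p/s ≤ 2m`, on `1 ≤ 2 log 2`,
and on `s ≤ (R + 1)k`; the last is where the constant acquires its dependence on `R`. -/
theorem mul_log_le {p r k m s R : ℕ} (hr : 1 ≤ r) (hrR : r ≤ R) (hsk : s = r + k) (hk : 0 < k)
    (hsp : s ≤ p) (hm : m = (p - r) / k) :
    s * Real.log (Real.exp 1 * p / s) ≤ 3 * (R + 1) * (k * Real.log (2 * m)) := by
  have hkp : k ≤ p - r := by omega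
  have hm1 : 1 ≤ m := by rw [hm]; exact (Nat.one_le_div_iff hk).2 hkp
  have hlt : p - r < (m + 1) * k := by
    rw [hm, mul_comm]; exact Nat.lt_mul_div_succ _ hk
  have hle : p - r ≤ 2 * m * k := by nlinarith
  have hs0 : (0 : ℝ) < s := by exact_mod_cast (by omega : 0 < s)
  have hp0 : (0 : ℝ) < p := by exact_mod_cast (by omega : 0 < p)
  have hps : (p : ℝ) / s ≤ 2 * m := by
    rw [div_le_iff₀ hs0]
    have : p ≤ 2 * m * s := by
      rw [hsk, mul_add]
      have : r ≤ 2 * m * r := Nat.le_mul_of_pos_left _ (by omega)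
      omega
    exact_mod_cast this
  have hm1' : (1 : ℝ) ≤ m := by exact_mod_cast hm1
  have hL2 : Real.log 2 ≤ Real.log (2 * m) := Real.log_le_log two_pos (by linarith)
  have hlog : Real.log (Real.exp 1 * p / s) ≤ 3 * Real.log (2 * m) := by
    rw [mul_div_assoc, Real.log_mul (Real.exp_pos 1).ne' (by positivity), Real.log_exp]
    have h1 : Real.log (p / s) ≤ Real.log (2 * m) := Real.log_le_log (by positivity) hps
    have h2 := Real.log_two_gt_d9
    linarith
  have hsR : (s : ℝ) ≤ (R + 1) * k := by
    have : s ≤ (R + 1) * k := by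
      rw [hsk]
      have : R ≤ R * k := Nat.le_mul_of_pos_right _ hk
      nlinarith
    exact_mod_cast this
  have hL0 : 0 ≤ Real.log (2 * m) := by
    have := Real.log_pos one_lt_two
    linarith
  calc s * Real.log (Real.exp 1 * p / s) ≤ s * (3 * Real.log (2 * m)) := by gcongr
    _ ≤ ((R + 1) * k) * (3 * Real.log (2 * m)) := by gcongr
    _ = 3 * (R + 1) * (k * Real.log (2 * m)) := by ring

/-- The minimax lower bound at the rate `s log(ep/s) / (n lam²) ∨ ε² / lam²`. -/
theorem minimaxProb_lower_bound (M : ℝ) (hM : 0 < M) (R : ℕ) :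
    ∃ C c c' : ℝ, 0 < C ∧ 0 < c ∧ 0 < c' ∧
      ∀ (n p r s : ℕ) (lam ε : ℝ), 1 ≤ n → 1 ≤ r → r ≤ R → r < s → s ≤ p →
        0 < lam → lam ≤ M → 0 ≤ ε → ε ≤ 1 →
          ENNReal.ofReal c ≤
            minimaxProb n p r s lam M ε
              (min (C * rate n p s lam ε) c') := by
  have hlog2 : 0 < Real.log 2 := Real.log_pos one_lt_two
  set b : ℝ := 1 / (4 * (M + 1) ^ 2) with hb
  have hb0 : 0 < b := by positivity
  -- `1536 = 3 · 32 · 16`: the `3` of `mul_log_le`, the `32` of the rotation budget and the `16` of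
  -- the loss threshold. The cap `b` keeps the rotation small enough for every side condition,
  -- uniformly over `lam ≤ M`.
  refine ⟨1 / (1536 * (R + 1)), 1 - Real.exp (-(Real.log 2 / 32)), b / 16, by positivity, ?_,
    by positivity, ?_⟩
  · have : Real.exp (-(Real.log 2 / 32)) < 1 := by rw [Real.exp_lt_one_iff]; linarith
    linarith
  intro n p r s lam ε hn hr hrR hrs hsp hlam hlamM hε0 hε1
  have hn0 : (0 : ℝ) < n := by exact_mod_cast hn
  obtain ⟨r, rfl⟩ : ∃ r', r = r' + 1 := ⟨r - 1, by omega⟩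
  -- consequences of the cap `b` on the squared sine of the rotation
  have hcap : ∀ d : ℝ, 0 < d → d ≤ b → d ≤ 1 / 2 ∧ 2 * lam * d < 1 ∧ 4 * lam ^ 2 * d ≤ 1 := by
    intro d hd hdb
    rw [hb, le_div_iff₀ (by positivity)] at hdb
    refine ⟨?_, ?_, ?_⟩
    · nlinarith [mul_pos hd hM, mul_pos hd (mul_pos hM hM)]
    · nlinarith [mul_pos hd hM, mul_pos hd (mul_pos hM hM), mul_le_mul_of_nonneg_left hlamM hd.le]
    · have : lam ^ 2 ≤ M ^ 2 := by gcongr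
      nlinarith [mul_pos hd hM, mul_le_mul_of_nonneg_left this hd.le]
  have hrot : ∀ d : ℝ, 0 < d → d ≤ 1 / 2 → ∃ c σ : ℝ, c ^ 2 + σ ^ 2 = 1 ∧ σ ≠ 0 ∧ σ ^ 2 = d := by
    intro d hd hd2
    exact ⟨Real.sqrt (1 - d), Real.sqrt d, by
      rw [Real.sq_sqrt (by linarith), Real.sq_sqrt hd.le]; ring, (Real.sqrt_pos.2 hd).ne',
      Real.sq_sqrt hd.le⟩
  set F := (s : ℝ) * Real.log (Real.exp 1 * p / s) / (n * lam ^ 2) with hF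
  have hs0 : (0 : ℝ) < s := by exact_mod_cast (by omega : 0 < s)
  have hF0 : 0 ≤ F := by
    have h1 : (1 : ℝ) ≤ p / s := by
      rw [one_le_div hs0]; exact_mod_cast hsp
    have h2 : 1 ≤ Real.exp 1 * p / s := by
      rw [mul_div_assoc]
      exact one_le_mul_of_one_le_of_one_le (Real.one_le_exp zero_le_one) h1
    have := Real.log_nonneg h2
    positivity
  have hR : (1 : ℝ) ≤ 1536 * (R + 1) := by
    have : (0 : ℝ) ≤ R := Nat.cast_nonneg R
    linarith
  -- When `ε = 0` the contamination term vanishes and `F ≥ 0` is the maximum, so that case belongs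
  -- with the sparsity bound.
  by_cases hcase : 0 < ε ∧ F ≤ ε ^ 2 / lam ^ 2
  · obtain ⟨hε, hle⟩ := hcase
    -- A single sparse direction suffices here, so one block with one position is used; the strict
    -- inequality between rank and sparsity leaves room for this extra coordinate.
    obtain ⟨ι⟩ : Nonempty (Fin (r + 1) ⊕ (Fin 1 × Fin 1) ↪ Fin p) :=
      Function.Embedding.nonempty_of_card_le (by simp; omega)
    set d := min (ε ^ 2 / (4 * lam ^ 2)) b with hd
    have hd0 : 0 < d := lt_min (by positivity) hb0
    obtain ⟨h1, h2, h3⟩ := hcap d hd0 (min_le_right _ _)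
    obtain ⟨c, σ, hcσ, hσ0, hσ⟩ := hrot d hd0 h1
    have ht : min (1 / (1536 * (R + 1)) * rate n p s lam ε) (b / 16) ≤ σ ^ 2 / 16 := by
      rw [hσ, hd, ← min_div_div_right (by norm_num : (0 : ℝ) ≤ 16)]
      refine min_le_min ?_ le_rfl
      rw [rate, max_eq_right hle]
      have e : ε ^ 2 / (4 * lam ^ 2) / 16 = 1 / 64 * (ε ^ 2 / lam ^ 2) := by field_simp; norm_num
      rw [e]
      gcongr
      linarith
    refine le_trans (le_minimaxProb fun Vhat hV => ?_) (minimaxProb_anti ht)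
    obtain ⟨c', σ', hcσ', Q, hQ⟩ := exists_frame_loss_of_contamination ι one_pos hlam.le hcσ hσ0
      (by rwa [hσ]) (by rwa [hσ]) hε hε1 (by
        rw [hσ]
        have : d ≤ ε ^ 2 / (4 * lam ^ 2) := min_le_left _ _
        rwa [le_div_iff₀ (by positivity), mul_comm] at this) (fun _ => (0, true)) Vhat
    refine ⟨_, _, isSparseSpiked_frame ι one_pos hcσ' _ (by omega) hlamM, Q, le_trans ?_ hQ⟩
    refine ENNReal.ofReal_le_ofReal ?_
    have h5 : Real.exp (-Real.log 2) ≤ Real.exp (-(Real.log 2 / 32)) :=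
      Real.exp_le_exp.2 (by linarith)
    rw [Real.exp_neg, Real.exp_log two_pos] at h5
    norm_num at h5 ⊢
    linarith
  · have hmax : rate n p s lam ε = F := by
      rw [rate]
      refine max_eq_left ?_
      rcases hε0.eq_or_lt with h | h
      · rw [← h]; simpa using hF0
      · exact (not_le.1 fun h' => hcase ⟨h, h'⟩).le
    obtain ⟨k, hsk⟩ : ∃ k, s = r + 1 + k := ⟨s - (r + 1), by omega⟩
    have hk : 0 < k := by omega
    -- The coordinates not used by the unrotated spikes are cut into `k` blocks of equal length, up
    -- to a remainder.
    set m := (p - (r + 1)) / k with hm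
    have hm1 : 0 < m := Nat.div_pos (by omega) hk
    obtain ⟨ι⟩ : Nonempty (Fin (r + 1) ⊕ (Fin k × Fin m) ↪ Fin p) :=
      Function.Embedding.nonempty_of_card_le (by
        have : k * m ≤ p - (r + 1) := Nat.mul_div_le _ _
        simp; omega)
    have hml := mul_log_le hr hrR hsk hk hsp hm
    have hm1' : (1 : ℝ) ≤ m := by exact_mod_cast hm1
    have hL0 : 0 < Real.log (2 * m) := Real.log_pos (by linarith)
    have hk0 : (0 : ℝ) < k := by exact_mod_cast hk
    set d := min (k * Real.log (2 * m) / (32 * (n * lam ^ 2))) b with hd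
    have hd0 : 0 < d := lt_min (by positivity) hb0
    obtain ⟨h1, h2, h3⟩ := hcap d hd0 (min_le_right _ _)
    obtain ⟨c, σ, hcσ, hσ0, hσ⟩ := hrot d hd0 h1
    have ht : min (1 / (1536 * (R + 1)) * rate n p s lam ε) (b / 16) ≤ σ ^ 2 / 16 := by
      rw [hσ, hd, ← min_div_div_right (by norm_num : (0 : ℝ) ≤ 16)]
      refine min_le_min ?_ le_rfl
      rw [hmax, hF]
      have hR' : (0 : ℝ) < R + 1 := by positivity
      calc 1 / (1536 * (R + 1)) * (s * Real.log (Real.exp 1 * p / s) / (n * lam ^ 2))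
          ≤ 1 / (1536 * (R + 1)) * (3 * (R + 1) * (k * Real.log (2 * m)) / (n * lam ^ 2)) := by
            gcongr
        _ = k * Real.log (2 * m) / (32 * (n * lam ^ 2)) / 16 := by field_simp; norm_num
    refine le_trans (le_minimaxProb fun Vhat hV => ?_) (minimaxProb_anti ht)
    obtain ⟨θ, Q, hQ⟩ := exists_frame_loss_of_sparsity ι hk hm1 hlam.le hcσ hσ0 (by rwa [hσ])
      (by rwa [hσ]) (by rwa [hσ]) (by
        rw [hσ]
        have : d ≤ k * Real.log (2 * m) / (32 * (n * lam ^ 2)) := min_le_left _ _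
        rwa [le_div_iff₀ (by positivity), mul_comm] at this) hε0 hε1 hV
    exact ⟨_, _, isSparseSpiked_frame ι hk hcσ θ hsk.ge hlamM, Q, hQ⟩

end RobustPCA

theorem theorem3p9 (M : ℝ) (hM : 0 < M) (R : ℕ) :
    ∃ C c c' : ℝ, 0 < C ∧ 0 < c ∧ 0 < c' ∧
      ∀ (n p r s : ℕ) (lam ε : ℝ), 1 ≤ n → 1 ≤ r → r ≤ R → r < s → s ≤ p →
        0 < lam → lam ≤ M → 0 ≤ ε → ε ≤ 1 →
          ENNReal.ofReal c ≤
            RobustPCA.minimaxProb n p r s lam M ε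
              (min (C * RobustPCA.rate n p s lam ε) c') :=
  RobustPCA.minimaxProb_lower_bound M hM R
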